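/- Let $d\ge 2$, let $\Delta\subset\mathbb R^d$ be a bounded set, let $\Delta(r)=r\Delta$ for $r>0$, and let $\sigma$ be the $(d-1)$-dimensional surface (Euclidean-normalised Hausdorff) measure. Assume that $\partial\Delta$ is an Ahlfors--David regular hypersurface: it has more than one point, and there is a constant $C>0$ such that for every $y\in\partial\Delta$ $$\sigma(\partial\Delta\cap B(y,s))<C s^{d-1}\quad (s>0),\qquad C^{-1}s^{d-1}<\sigma(\partial\Delta\cap B(y,s))\quad (0<s\le\operatorname{diam}\partial\Delta).$$ Let $H_k$ be the (probabilists') Hermite polynomials, $\phi$ the standard normal density, $G\in L_2(\mathbb R,\phi(w)\,dw)$ and $C_k=\int_{\mathbb R}G(w)H_k(w)\phi(w)\,dw$. Assume that $G$ has Hermite rank $\kappa\ge 1$, that is, $C_j=0$ for $0\le j\le\kappa-1$ and $C_\kappa\ne0$. Let $\eta(x)$, $x\in\mathbb R^d$, be a measurable, mean-square continuous, zero-mean, homogeneous and isotropic real Gaussian random field with $\mathbf E\,\eta(0)^2=1$ and $$\mathbf E\,\eta(0)\eta(x)=\|x\|^{-\alpha}L_0(\|x\|),\qquad x\neq 0,$$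 where $L_0:(0,\infty)\to(0,\infty)$ is measurable and slowly varying at infinity (that is, $L_0(\lambda t)/L_0(\lambda)\to1$ as $\lambda\to\infty$ for all $t>0$) and $0<\alpha<(d-1)/\kappa$. Put $$K_r=\int_{\partial\Delta(r)}G(\eta(x))\,d\sigma(x),\qquad K_{r,\kappa}=\frac{C_\kappa}{\kappa!}\int_{\partial\Delta(r)}H_\kappa(\eta(x))\,d\sigma(x).$$ Then for every $r>0$ both integrals exist almost surely, and $K_r$ and $K_{r,\kappa}$ are square integrable with positive variance; $$\lim_{r\to\infty}\frac{\mathbf{Var}(K_r-K_{r,\kappa})}{\mathbf{Var}\,K_r}=0;$$ and if at least one of the random variables $$\frac{K_r}{\sqrt{\mathbf{Var}\,K_r}},\qquad \frac{K_r}{\sqrt{\mathbf{Var}\,K_{r,\kappa}}},\qquad \frac{K_{r,\kappa}}{\sqrt{\mathbf{Var}\,K_{r,\kappa}}}$$ has a limit distribution (in the sense of weak convergence of laws) as $r\to\infty$, then so do the other two, and the three limit distributions coincide. -/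

import Mathlib

open MeasureTheory ProbabilityTheory Filter Topology
open scoped Pointwise

noncomputable section

/-- A closed set `S` in `ℝᵈ` is an Ahlfors–David regular hypersurface: its `(d-1)`-dimensional
surface measure `μHE[d-1]` (the Hausdorff measure with the Euclidean normalisation) is comparable
with `s ^ (d-1)` on all balls of radius `s` centred on `S`. For a bounded set the lower bound can
only be asked for radii up to the diameter. `S.Nontrivial` (at least two points) excludes the
degenerate cases of the empty set and of a point, where the lower bound would be void. -/
def IsAhlforsDavidRegularHypersurface {d : ℕ} (S : Set (EuclideanSpace ℝ (Fin d))) : Prop :=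
  IsClosed S ∧ S.Nontrivial ∧ ∃ C : ℝ, 0 < C ∧ ∀ y ∈ S, ∀ s : ℝ, 0 < s →
    (s ≤ Metric.diam S →
      ENNReal.ofReal (C⁻¹ * s ^ (d - 1)) < μHE[d - 1] (S ∩ Metric.ball y s)) ∧
    μHE[d - 1] (S ∩ Metric.ball y s) < ENNReal.ofReal (C * s ^ (d - 1))

/-- `L : (0,∞) → (0,∞)` is measurable and slowly varying at infinity. Values of `L` outside
`(0,∞)` are irrelevant. -/
structure IsSlowlyVarying (L : ℝ → ℝ) : Prop where
  measurable : Measurable ((Set.Ioi (0 : ℝ)).domRestrict L)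
  pos : ∀ x : ℝ, 0 < x → 0 < L x
  tendsto : ∀ t : ℝ, 0 < t → Tendsto (fun l : ℝ => L (l * t) / L l) atTop (𝓝 1)

/-- A (jointly) measurable, mean-square continuous, zero-mean, homogeneous and isotropic real
Gaussian random field on `ℝᵈ`. As the field is Gaussian with mean zero, its law is invariant under
the isometries of `ℝᵈ` if and only if the covariance of `η x` and `η y` depends only on the
distance between `x` and `y`. -/
structure IsHomogeneousIsotropicGaussianField {d : ℕ} {Ω : Type*} [MeasurableSpace Ω]
    (η : EuclideanSpace ℝ (Fin d) → Ω → ℝ) (P : Measure Ω) : Prop where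
  measurable : Measurable (Function.uncurry η)
  gaussian : IsGaussianProcess η P
  mean_zero : ∀ x, ∫ ω, η x ω ∂P = 0
  meanSquare_continuous :
    ∀ x, Tendsto (fun y => ∫ ω, (η y ω - η x ω) ^ 2 ∂P) (𝓝 x) (𝓝 0)
  covariance_eq : ∀ x y x' y' : EuclideanSpace ℝ (Fin d), dist x y = dist x' y' →
    cov[η x, η y; P] = cov[η x', η y'; P]

/-- `η` is a homogeneous isotropic Gaussian field with unit variance and covariance function
`B(x) = E η(0) η(x) = ‖x‖ ^ (-α) * L₀(‖x‖)` for `x ≠ 0`, where `L₀` is slowly varying at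
infinity. -/
structure HasRegularlyVaryingCovariance {d : ℕ} {Ω : Type*} [MeasurableSpace Ω]
    (η : EuclideanSpace ℝ (Fin d) → Ω → ℝ) (P : Measure Ω) (α : ℝ) (L₀ : ℝ → ℝ) : Prop where
  field : IsHomogeneousIsotropicGaussianField η P
  slowlyVarying : IsSlowlyVarying L₀
  variance_one : ∫ ω, η 0 ω * η 0 ω ∂P = 1
  covariance : ∀ x : EuclideanSpace ℝ (Fin d), x ≠ 0 →
    ∫ ω, η 0 ω * η x ω ∂P = ‖x‖ ^ (-α) * L₀ ‖x‖

/-- The (probabilists') Hermite polynomial `H_k` evaluated at a real number. -/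
def hermiteEval (k : ℕ) (w : ℝ) : ℝ := Polynomial.aeval w (Polynomial.hermite k)

/-- The Hermite coefficient `C_k = ∫ G(w) H_k(w) φ(w) dw`, `φ` the standard normal density. -/
def hermiteCoeff (G : ℝ → ℝ) (k : ℕ) : ℝ :=
  ∫ w, G w * hermiteEval k w ∂(gaussianReal 0 1)

/-- `G ∈ L₂(ℝ, φ(w) dw)` has Hermite rank `κ ≥ 1`. -/
structure HasHermiteRank (G : ℝ → ℝ) (κ : ℕ) : Prop where
  memLp : MemLp G 2 (gaussianReal 0 1)
  one_le : 1 ≤ κ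
  coeff_eq_zero : ∀ j < κ, hermiteCoeff G j = 0
  coeff_ne_zero : hermiteCoeff G κ ≠ 0

/-- The integral `∫_{∂Δ(r)} F(η(x)) dσ(x)` over the boundary of the dilation `Δ(r) = r • Δ`. -/
def surfaceFunctional {d : ℕ} {Ω : Type*} (Δ : Set (EuclideanSpace ℝ (Fin d)))
    (η : EuclideanSpace ℝ (Fin d) → Ω → ℝ) (F : ℝ → ℝ) (r : ℝ) (ω : Ω) : ℝ :=
  ∫ x in frontier (r • Δ), F (η x ω) ∂μHE[d - 1]

/-- The component `K_{r,κ} = (C_κ / κ!) ∫_{∂Δ(r)} H_κ(η(x)) dσ(x)`. -/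
def hermiteComponent {d : ℕ} {Ω : Type*} (Δ : Set (EuclideanSpace ℝ (Fin d)))
    (η : EuclideanSpace ℝ (Fin d) → Ω → ℝ) (G : ℝ → ℝ) (κ : ℕ) (r : ℝ) (ω : Ω) : ℝ :=
  hermiteCoeff G κ / (κ.factorial : ℝ) * surfaceFunctional Δ η (hermiteEval κ) r ω

/-- The random variables `X r` have the limit distribution `ν` as `r → ∞`: their laws under `P`
converge weakly to `ν`. -/
def HasLimitDistribution {Ω : Type*} [MeasurableSpace Ω] (P : Measure Ω) [IsProbabilityMeasure P]
    (X : ℝ → Ω → ℝ) (ν : Measure ℝ) [IsProbabilityMeasure ν] : Prop :=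
  TendstoInDistribution X atTop (id : ℝ → ℝ) (fun _ => P) ν

end

/-! ### Hermite polynomials and Gaussian integrals -/

/-! Write `B` for the covariance of the field. Mean-square continuity and `L₀ > 0` make `B` a
continuous function of the distance with values in `(0, 1]`.

Hermite components of different orders are uncorrelated (`integral_comp_mul_hermiteEval_comp`), so
`Var K = Var Kκ + Var (K - Kκ)` (`variance_eq_add`). The leading variance is exactly `C_κ² / κ!`
times the double integral of `B ^ κ` over the dilated surface. The remainder has Hermite rank at
least `κ + 1`, so Gebelein's inequality (`abs_integral_comp_mul_comp_le`) bounds its variance by a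
constant times the double integral of `B ^ (κ + 1)`.

The ratio of these integrals tends to zero (`tendsto_integral_covariance_pow_div`). Where `dist x y
≥ T` one has `B ≤ ε`, hence `B ^ (κ + 1) ≤ ε * B ^ κ`. Pairs closer than `T` have product measure
`O(r ^ (d - 1))`, by Ahlfors–David regularity. The integral of `B ^ κ` is at least a constant times
`r ^ (2 * (d - 1) - β * κ)` for large `r` and any `β > α`. As `α * κ < d - 1`, `β` can be chosen
with `β * κ < d - 1`, and the close pairs become negligible. Only the total mass and the diameter of
the surface enter this lower bound, so no exact asymptotics of the integral are needed.

After normalisation the three variables then differ by quantities tending to zero in mean square,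
and Slutsky's argument transfers limit laws between them. -/

open Polynomial in
theorem derivative_hermite_succ (k : ℕ) :
    derivative (hermite (k + 1)) = (k + 1 : ℕ) • hermite k := by
  induction k with
  | zero => simp [hermite_zero]
  | succ k ih =>
    rw [hermite_succ (k + 1), derivative_sub, derivative_mul, derivative_X, ih]
    rw [derivative_smul, show (k + 1 + 1 : ℕ) • hermite (k + 1)
      = hermite (k + 1) + (k + 1 : ℕ) • hermite (k + 1) by rw [succ_nsmul, add_comm]]
    conv_rhs => rw [hermite_succ k]
    rw [smul_sub, hermite_succ k]
    ring_nf

theorem hermiteEval_zero (w : ℝ) : hermiteEval 0 w = 1 := by simp [hermiteEval]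

theorem hermiteEval_one (w : ℝ) : hermiteEval 1 w = w := by
  simp [hermiteEval]

theorem hermiteEval_succ_succ (k : ℕ) (w : ℝ) :
    hermiteEval (k + 2) w = w * hermiteEval (k + 1) w - (k + 1) * hermiteEval k w := by
  simp only [hermiteEval]
  rw [Polynomial.hermite_succ (k + 1), derivative_hermite_succ]
  simp

theorem hermiteEval_eq_eval (k : ℕ) (w : ℝ) :
    hermiteEval k w = ((Polynomial.hermite k).map (Int.castRingHom ℝ)).eval w := by
  simp [hermiteEval, Polynomial.aeval_def, Polynomial.eval_map]

theorem continuous_hermiteEval (k : ℕ) : Continuous (hermiteEval k) := by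
  unfold hermiteEval; fun_prop

theorem memLp_pow_gaussianReal (m : ℝ) (v : NNReal) (n : ℕ) (p : ENNReal) (hp : p ≠ ⊤) :
    MemLp (fun x => x ^ n) p (gaussianReal m v) := by
  rcases Nat.eq_zero_or_pos n with rfl | hn
  · simpa using memLp_const (1 : ℝ)
  · have h := (memLp_id_gaussianReal' (μ := m) (v := v) (n * p)
      (ENNReal.mul_ne_top (by simp) hp)).norm_rpow_div (n : ENNReal)
    have hn' : (n : ENNReal) ≠ 0 := by simpa using hn.ne'
    rw [mul_comm, ENNReal.mul_div_cancel_right hn' (by simp)] at h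
    refine h.mono (by fun_prop) (ae_of_all _ fun x => ?_)
    simp

theorem memLp_polynomial_gaussianReal (m : ℝ) (v : NNReal) (q : Polynomial ℝ) (p : ENNReal)
    (hp : p ≠ ⊤) : MemLp (fun x => q.eval x) p (gaussianReal m v) := by
  simp only [Polynomial.eval_eq_sum, Polynomial.sum]
  exact memLp_finsetSum _ fun i _ => (memLp_pow_gaussianReal m v i p hp).const_mul _

theorem integrable_polynomial_gaussianReal (m : ℝ) (v : NNReal) (q : Polynomial ℝ) :
    Integrable (fun x => q.eval x) (gaussianReal m v) :=
  memLp_one_iff_integrable.1 (memLp_polynomial_gaussianReal m v q 1 (by simp))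

theorem memLp_hermiteEval (k : ℕ) (p : ENNReal) (hp : p ≠ ⊤) :
    MemLp (hermiteEval k) p (gaussianReal 0 1) := by
  simpa only [← hermiteEval_eq_eval] using memLp_polynomial_gaussianReal 0 1
    ((Polynomial.hermite k).map (Int.castRingHom ℝ)) p hp

/-- **Stein's identity** for polynomials. -/
theorem integral_id_mul_polynomial_gaussianReal (v : NNReal) (q : Polynomial ℝ) :
    ∫ x, x * q.eval x ∂(gaussianReal 0 v) = v * ∫ x, q.derivative.eval x ∂(gaussianReal 0 v) := by
  rcases eq_or_ne v 0 with rfl | hv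
  · simp
  have hv' : (v : ℝ) ≠ 0 := by simpa using hv
  have hint (q : Polynomial ℝ) : Integrable (fun x => q.eval x * gaussianPDFReal 0 v x) := by
    have h := integrable_polynomial_gaussianReal 0 v q
    rw [gaussianReal_of_var_ne_zero _ hv, integrable_withDensity_iff_integrable_smul'
      (measurable_gaussianPDF 0 v) (ae_of_all _ fun _ => gaussianPDF_lt_top)] at h
    simpa [mul_comm] using h
  have hder (x : ℝ) : HasDerivAt (gaussianPDFReal 0 v) (-(x / v) * gaussianPDFReal 0 v x) x := by
    have h1 : HasDerivAt (fun x : ℝ => -(x - 0) ^ 2 / (2 * v)) (-(x / v)) x := by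
      have := (((hasDerivAt_id x).sub_const 0).pow 2).neg.div_const (2 * (v : ℝ))
      refine this.congr_deriv ?_
      simp
      field_simp
    have h2 := h1.exp.const_mul (√(2 * Real.pi * v))⁻¹
    rw [gaussianPDFReal_def]
    exact h2.congr_deriv (by ring)
  have hparts := integral_mul_deriv_eq_deriv_mul_of_integrable (u := fun x => q.eval x)
    (v := gaussianPDFReal 0 v) (u' := fun x => q.derivative.eval x)
    (v' := fun x => -(x / v) * gaussianPDFReal 0 v x)
    (fun x _ => q.hasDerivAt x) (fun x _ => hder x) ?_ (hint _) (hint _)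
  · rw [integral_gaussianReal_eq_integral_smul hv, integral_gaussianReal_eq_integral_smul hv]
    have e1 : ∫ x, gaussianPDFReal 0 v x • (x * q.eval x)
        = -(v * ∫ x, q.eval x * (-(x / v) * gaussianPDFReal 0 v x)) := by
      rw [← integral_const_mul, ← integral_neg]
      congr 1; ext x; simp only [smul_eq_mul]; field_simp
    rw [e1, hparts, mul_neg, neg_neg]
    congr 2; ext x; simp [mul_comm]
  · have := (hint (Polynomial.X * q)).const_mul (-(v : ℝ)⁻¹)
    refine this.congr (ae_of_all _ fun x => ?_)
    simp; field_simp

/-- Stein's identity for a translated Hermite polynomial; it supplies the induction step of Mehler's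
formula. -/
theorem integral_id_mul_hermiteEval_comp (v : NNReal) (a : ℝ) (k : ℕ) :
    ∫ z, z * hermiteEval (k + 1) (a + z) ∂(gaussianReal 0 v)
      = v * ((k + 1) * ∫ z, hermiteEval k (a + z) ∂(gaussianReal 0 v)) := by
  have h := integral_id_mul_polynomial_gaussianReal v
    (((Polynomial.hermite (k + 1)).map (Int.castRingHom ℝ)).comp
      (Polynomial.C a + Polynomial.X))
  simp only [Polynomial.eval_comp, ← hermiteEval_eq_eval, Polynomial.derivative_comp,
    Polynomial.derivative_map, derivative_hermite_succ] at h
  simp [Polynomial.map_mul, ← hermiteEval_eq_eval] at h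
  rw [← integral_const_mul]
  exact h

theorem integrable_hermiteEval_comp (v : NNReal) (a : ℝ) (k : ℕ) :
    Integrable (fun z => hermiteEval k (a + z)) (gaussianReal 0 v) :=
  (integrable_polynomial_gaussianReal 0 v (((Polynomial.hermite k).map (Int.castRingHom ℝ)).comp
    (Polynomial.C a + Polynomial.X))).congr
    (ae_of_all _ fun z => by simp [hermiteEval_eq_eval, Polynomial.eval_comp])

theorem integrable_id_mul_hermiteEval_comp (v : NNReal) (a : ℝ) (k : ℕ) :
    Integrable (fun z => z * hermiteEval k (a + z)) (gaussianReal 0 v) :=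
  (integrable_polynomial_gaussianReal 0 v (Polynomial.X *
    ((Polynomial.hermite k).map (Int.castRingHom ℝ)).comp (Polynomial.C a + Polynomial.X))).congr
    (ae_of_all _ fun z => by simp [hermiteEval_eq_eval, Polynomial.eval_comp])

/-- **Mehler's formula**: Hermite polynomials are eigenfunctions of the Ornstein–Uhlenbeck
averages. -/
theorem integral_hermiteEval_mehler (ρ : ℝ) (v : NNReal) (hv : (v : ℝ) = 1 - ρ ^ 2) (x : ℝ) :
    ∀ k : ℕ, ∫ z, hermiteEval k (ρ * x + z) ∂(gaussianReal 0 v) = ρ ^ k * hermiteEval k x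
  | 0 => by simp [hermiteEval_zero]
  | 1 => by
    simp only [hermiteEval_one]
    rw [integral_add (g := fun z => z) (integrable_const _)
      (memLp_one_iff_integrable.1 (memLp_id_gaussianReal' 1 (by simp)))]
    simp [integral_id_gaussianReal]
  | k + 2 => by
    have h1 := integral_hermiteEval_mehler ρ v hv x k
    have h2 := integral_hermiteEval_mehler ρ v hv x (k + 1)
    -- The three-term recurrence at `ρ * x + z`, followed by Stein's identity on the term with
    -- factor `z`, leaves the coefficient `(v - 1) * (k + 1) = -ρ ^ 2 * (k + 1)` on the lower order
    -- term. This is the recurrence for `H_{k+2}(x)` multiplied by `ρ ^ (k + 2)`.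
    simp only [hermiteEval_succ_succ, add_mul (ρ * x)]
    rw [integral_sub, integral_add, integral_const_mul, integral_const_mul,
      integral_id_mul_hermiteEval_comp, h1, h2, hv]
    · ring
    · exact (integrable_hermiteEval_comp v _ _).const_mul _
    · exact integrable_id_mul_hermiteEval_comp v _ _
    · exact ((integrable_hermiteEval_comp v _ _).const_mul _).add
        (integrable_id_mul_hermiteEval_comp v _ _)
    · exact (integrable_hermiteEval_comp v (ρ * x) k).const_mul ((k : ℝ) + 1)

theorem integrable_hermiteEval_mul_hermiteEval (j k : ℕ) :
    Integrable (fun x => hermiteEval j x * hermiteEval k x) (gaussianReal 0 1) :=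
  (memLp_hermiteEval j 2 (by simp)).integrable_mul (memLp_hermiteEval k 2 (by simp))

/-- Stein's identity for `H_{j+1} * H_k`: one summand of the derivative combines with the left side
through `x * H_k - H_k' = H_{k+1}`, the other is `(j + 1) * H_j * H_k`. -/
theorem integral_hermiteEval_succ_mul_hermiteEval_succ (j k : ℕ) :
    ∫ x, hermiteEval (j + 1) x * hermiteEval (k + 1) x ∂(gaussianReal 0 1)
      = (j + 1) * ∫ x, hermiteEval j x * hermiteEval k x ∂(gaussianReal 0 1) := by
  have h := integral_id_mul_polynomial_gaussianReal 1
    ((Polynomial.hermite (j + 1) * Polynomial.hermite k).map (Int.castRingHom ℝ))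
  have hs (x : ℝ) : hermiteEval (k + 1) x
      = x * hermiteEval k x - Polynomial.aeval x (Polynomial.hermite k).derivative := by
    simp [hermiteEval, Polynomial.hermite_succ]
  have e1 : ∀ x : ℝ, ((Polynomial.hermite (j + 1) * Polynomial.hermite k).map
      (Int.castRingHom ℝ)).eval x = hermiteEval (j + 1) x * hermiteEval k x := fun x => by
    simp [hermiteEval_eq_eval]
  have e2 : ∀ x : ℝ, ((Polynomial.hermite (j + 1) * Polynomial.hermite k).map
      (Int.castRingHom ℝ)).derivative.eval x = (j + 1) * (hermiteEval j x * hermiteEval k x)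
        + hermiteEval (j + 1) x * Polynomial.aeval x (Polynomial.hermite k).derivative :=
      fun x => by
    rw [Polynomial.derivative_map, Polynomial.derivative_mul, derivative_hermite_succ]
    simp [hermiteEval_eq_eval, Polynomial.aeval_def, Polynomial.eval_map]
    ring
  have i1 : Integrable (fun x : ℝ => (j + 1 : ℝ) * (hermiteEval j x * hermiteEval k x))
      (gaussianReal 0 1) := (integrable_hermiteEval_mul_hermiteEval j k).const_mul _
  have i2 : Integrable (fun x : ℝ => hermiteEval (j + 1) x
      * Polynomial.aeval x (Polynomial.hermite k).derivative) (gaussianReal 0 1) := by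
    have := integrable_polynomial_gaussianReal 0 1 ((Polynomial.hermite (j + 1)
      * (Polynomial.hermite k).derivative).map (Int.castRingHom ℝ))
    simpa [hermiteEval_eq_eval, Polynomial.aeval_def, Polynomial.eval_map] using this
  have i3 : Integrable (fun x : ℝ => x * (hermiteEval (j + 1) x * hermiteEval k x))
      (gaussianReal 0 1) := by
    have := integrable_polynomial_gaussianReal 0 1 (Polynomial.X * (Polynomial.hermite (j + 1)
      * Polynomial.hermite k).map (Int.castRingHom ℝ))
    simpa [e1, hermiteEval_eq_eval] using this
  simp only [e1, e2] at h
  rw [integral_add i1 i2, integral_const_mul, NNReal.coe_one, one_mul] at h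
  rw [← sub_eq_iff_eq_add] at h
  rw [← h, ← integral_sub i3 i2]
  congr 1; ext x; rw [hs]; ring

theorem integral_hermiteEval_zero_mul_succ (k : ℕ) :
    ∫ x, hermiteEval 0 x * hermiteEval (k + 1) x ∂(gaussianReal 0 1) = 0 := by
  have h := integral_hermiteEval_mehler 0 1 (by simp) 0 (k + 1)
  simpa [hermiteEval_zero] using h

/-- Hermite polynomials are orthogonal for the standard Gaussian measure. -/
theorem integral_hermiteEval_mul_hermiteEval (j k : ℕ) :
    ∫ x, hermiteEval j x * hermiteEval k x ∂(gaussianReal 0 1)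
      = if j = k then (k.factorial : ℝ) else 0 := by
  induction j generalizing k with
  | zero =>
    cases k with
    | zero => simp [hermiteEval_zero]
    | succ k => simpa using integral_hermiteEval_zero_mul_succ k
  | succ j ih =>
    cases k with
    | zero =>
      have := integral_hermiteEval_zero_mul_succ j
      simp only [mul_comm] at this ⊢
      simpa using this
    | succ k =>
      rw [integral_hermiteEval_succ_mul_hermiteEval_succ, ih]
      by_cases h : j = k
      · subst h; simp [Nat.factorial_succ]
      · simp [h]

/-! ### Completeness of the Hermite polynomials and Gaussian correlation inequalities -/

theorem memLp_exp_abs_gaussianReal (t : ℝ) :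
    MemLp (fun x => Real.exp (t * |x|)) 2 (gaussianReal 0 1) := by
  rw [memLp_two_iff_integrable_sq (by fun_prop)]
  have h := integrable_exp_mul_abs (X := id) (μ := gaussianReal 0 1) (t := 2 * t)
    (integrable_exp_mul_gaussianReal _) (integrable_exp_mul_gaussianReal _)
  refine h.congr (ae_of_all _ fun x => ?_)
  simp only [id]
  rw [← Real.exp_nat_mul]
  push_cast
  ring_nf

/-- The exponential series may be integrated term by term because it is dominated by `|f x| * exp
(|t| * |x|)`, a product of two `L²` functions. -/
theorem integral_mul_cexp_eq_zero_of_moments {f : ℝ → ℝ} (hf : MemLp f 2 (gaussianReal 0 1))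
    (h : ∀ n : ℕ, ∫ x, f x * x ^ n ∂(gaussianReal 0 1) = 0) (t : ℝ) :
    ∫ x, (f x : ℂ) * Complex.exp (t * x * Complex.I) ∂(gaussianReal 0 1) = 0 := by
  have hfm := hf.aestronglyMeasurable
  have key := hasSum_integral_of_dominated_convergence (μ := gaussianReal 0 1)
    (F := fun (n : ℕ) (x : ℝ) => (f x : ℂ) * ((t * x * Complex.I) ^ n / n.factorial))
    (f := fun x => (f x : ℂ) * Complex.exp (t * x * Complex.I))
    (fun n x => |f x| * ((|t| * |x|) ^ n / n.factorial)) ?_ ?_ ?_ ?_ ?_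
  · have hz : ∀ n : ℕ, ∫ x, (f x : ℂ) * ((t * x * Complex.I) ^ n / n.factorial)
        ∂(gaussianReal 0 1) = 0 := fun n => by
      have e : ∀ x : ℝ, (f x : ℂ) * ((t * x * Complex.I) ^ n / n.factorial)
          = ((t * Complex.I) ^ n / n.factorial) * ((f x * x ^ n : ℝ) : ℂ) := fun x => by
        push_cast; ring
      simp_rw [e]
      rw [integral_const_mul, integral_complex_ofReal, h n]
      simp
    simp_rw [hz] at key
    exact key.unique hasSum_zero
  · intro n
    exact (Complex.continuous_ofReal.comp_aestronglyMeasurable hfm).mul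
      (by fun_prop : Measurable fun x : ℝ =>
        ((t * x * Complex.I) ^ n / n.factorial : ℂ)).aestronglyMeasurable
  · intro n
    refine ae_of_all _ fun x => le_of_eq ?_
    simp
  · refine ae_of_all _ fun x => ?_
    exact (Real.summable_pow_div_factorial _).mul_left _
  · have e : (fun x => ∑' n : ℕ, |f x| * ((|t| * |x|) ^ n / n.factorial))
        = fun x => |f x| * Real.exp (|t| * |x|) := by
      ext x
      rw [tsum_mul_left, Real.exp_eq_exp_ℝ, NormedSpace.exp_eq_tsum_div]
    rw [e]
    exact hf.abs.integrable_mul (memLp_exp_abs_gaussianReal _)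
  · refine ae_of_all _ fun x => ?_
    refine HasSum.mul_left _ ?_
    rw [Complex.exp_eq_exp_ℂ]
    exact NormedSpace.expSeries_div_hasSum_exp _

/-- The positive and negative parts of `f` are densities of two finite measures with the same
characteristic function; these measures agree, so the two parts agree almost everywhere and both
vanish. -/
theorem ae_eq_zero_of_integral_mul_cexp_eq_zero {μ : Measure ℝ} {f : ℝ → ℝ}
    (hf : Integrable f μ)
    (h : ∀ t : ℝ, ∫ x, (f x : ℂ) * Complex.exp (t * x * Complex.I) ∂μ = 0) :
    f =ᵐ[μ] 0 := by
  wlog hm : Measurable f generalizing f with H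
  · obtain ⟨g, hg, hfg⟩ := hf.aestronglyMeasurable
    refine hfg.trans (H (hf.congr hfg) (fun t => ?_) hg.measurable)
    rw [← h t]
    refine integral_congr_ae ?_
    filter_upwards [hfg] with x hx
    rw [hx]
  have hlt (g : ℝ → ℝ) (hg : Integrable g μ) : ∫⁻ x, ENNReal.ofReal (g x) ∂μ ≠ ⊤ :=
    ((lintegral_mono fun x => ENNReal.ofReal_le_ofReal (le_abs_self (g x))).trans_lt
      (by simpa [hasFiniteIntegral_iff_norm] using hg.hasFiniteIntegral)).ne
  have i1 := isFiniteMeasure_withDensity (hlt f hf)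
  have i2 := isFiniteMeasure_withDensity (hlt (fun x => -f x) hf.neg)
  have hc (g : ℝ → ℝ) (hg : Measurable g) (t : ℝ) :
      charFun (μ.withDensity fun x => ENNReal.ofReal (g x)) t
        = ∫ x, ((max (g x) 0 : ℝ) : ℂ) * Complex.exp (t * x * Complex.I) ∂μ := by
    rw [charFun_apply_real, integral_withDensity_eq_integral_toReal_smul (by fun_prop)
      (ae_of_all _ fun _ => ENNReal.ofReal_lt_top)]
    simp [ENNReal.toReal_ofReal']
  have hint (g : ℝ → ℝ) (hg : Integrable g μ) (t : ℝ) : Integrable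
      (fun x => ((max (g x) 0 : ℝ) : ℂ) * Complex.exp (t * x * Complex.I)) μ := by
    refine (hg.pos_part.ofReal (𝕜 := ℂ)).mul_bdd (c := 1) (by fun_prop) (ae_of_all _ fun x => ?_)
    have : (t * x * Complex.I : ℂ) = ((t * x : ℝ) : ℂ) * Complex.I := by push_cast; ring
    rw [this, Complex.norm_exp_ofReal_mul_I]
  have heq : (μ.withDensity fun x => ENNReal.ofReal (f x))
      = μ.withDensity fun x => ENNReal.ofReal (-f x) := by
    refine Measure.ext_of_charFun (funext fun t => ?_)
    rw [hc f hm, hc (fun x => -f x) hm.neg, ← sub_eq_zero, ← integral_sub (hint f hf t)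
      (hint (fun x => -f x) hf.neg t), ← h t]
    congr 1; ext x
    rw [← sub_mul, ← Complex.ofReal_sub]
    congr 2
    rcases le_total 0 (f x) with hx | hx
    · rw [max_eq_left hx, max_eq_right (by linarith)]; ring
    · rw [max_eq_right hx, max_eq_left (by linarith)]; ring
  rw [withDensity_eq_iff (by fun_prop) (by fun_prop) (hlt f hf)] at heq
  filter_upwards [heq] with x hx
  rcases le_total 0 (f x) with h0 | h0
  · rw [ENNReal.ofReal_of_nonpos (p := -f x) (by linarith), ENNReal.ofReal_eq_zero] at hx
    exact le_antisymm hx h0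
  · rw [ENNReal.ofReal_of_nonpos h0, eq_comm, ENNReal.ofReal_eq_zero] at hx
    exact le_antisymm h0 (neg_nonpos.1 hx)

/-- A function in `L²` of the standard Gaussian measure is zero as soon as all its Hermite
coefficients are. -/
theorem ae_eq_zero_of_hermiteCoeff_eq_zero {f : ℝ → ℝ} (hf : MemLp f 2 (gaussianReal 0 1))
    (h : ∀ k, hermiteCoeff f k = 0) : f =ᵐ[gaussianReal 0 1] 0 := by
  have hi (n k : ℕ) : Integrable (fun x => f x * (x ^ n * hermiteEval k x)) (gaussianReal 0 1) := by
    have hp := memLp_polynomial_gaussianReal 0 1 (Polynomial.X ^ n *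
      ((Polynomial.hermite k).map (Int.castRingHom ℝ))) 2 (by simp)
    refine hf.integrable_mul (hp.ae_eq (ae_of_all _ fun x => ?_))
    simp [hermiteEval_eq_eval]
  -- Each factor `x` is absorbed by `x * H_{k+1} = H_{k+2} + (k + 1) * H_k`, so `k` must stay free
  -- in the induction on `n`. The case `k = 0` gives all moments.
  have key : ∀ n k : ℕ, ∫ x, f x * (x ^ n * hermiteEval k x) ∂(gaussianReal 0 1) = 0 := by
    intro n
    induction n with
    | zero => intro k; simpa [hermiteCoeff] using h k
    | succ n ih =>
      intro k
      cases k with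
      | zero =>
        refine (integral_congr_ae (ae_of_all _ fun x => ?_)).trans (ih 1)
        simp [hermiteEval_zero, hermiteEval_one, pow_succ]
      | succ k =>
        have e : ∀ x, f x * (x ^ (n + 1) * hermiteEval (k + 1) x)
            = f x * (x ^ n * hermiteEval (k + 2) x)
              + (k + 1) * (f x * (x ^ n * hermiteEval k x)) := fun x => by
          rw [hermiteEval_succ_succ]; ring
        simp_rw [e]
        rw [integral_add (hi _ _) ((hi _ _).const_mul _), integral_const_mul, ih, ih]
        simp
  refine ae_eq_zero_of_integral_mul_cexp_eq_zero (hf.integrable (by norm_num)) fun t =>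
    integral_mul_cexp_eq_zero_of_moments hf (fun n => ?_) t
  simpa [hermiteEval_zero] using key n 0

theorem memLp_normalizedHermite (k : ℕ) :
    MemLp (fun x => (√k.factorial)⁻¹ * hermiteEval k x) 2 (gaussianReal 0 1) :=
  (memLp_hermiteEval k 2 (by simp)).const_mul _

noncomputable def normalizedHermite (k : ℕ) : Lp ℝ 2 (gaussianReal 0 1) :=
  (memLp_normalizedHermite k).toLp _

theorem inner_toLp_toLp {α : Type*} [MeasurableSpace α] {μ : Measure α} {f g : α → ℝ}
    (hf : MemLp f 2 μ) (hg : MemLp g 2 μ) :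
    inner ℝ (hf.toLp f) (hg.toLp g) = ∫ x, f x * g x ∂μ := by
  rw [L2.inner_def]
  refine integral_congr_ae ?_
  filter_upwards [hf.coeFn_toLp, hg.coeFn_toLp] with x h1 h2
  rw [h1, h2, real_inner_eq_re_inner, RCLike.inner_apply]
  simp [mul_comm]

theorem inner_normalizedHermite_toLp {f : ℝ → ℝ} (hf : MemLp f 2 (gaussianReal 0 1)) (k : ℕ) :
    inner ℝ (normalizedHermite k) (hf.toLp f) = (√k.factorial)⁻¹ * hermiteCoeff f k := by
  rw [normalizedHermite, inner_toLp_toLp, hermiteCoeff, ← integral_const_mul]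
  congr 1; ext x; ring

theorem orthonormal_normalizedHermite : Orthonormal ℝ normalizedHermite := by
  rw [orthonormal_iff_ite]
  intro i j
  rw [normalizedHermite, normalizedHermite, inner_toLp_toLp]
  have e : ∀ x, (√i.factorial)⁻¹ * hermiteEval i x * ((√j.factorial)⁻¹ * hermiteEval j x)
      = ((√i.factorial)⁻¹ * (√j.factorial)⁻¹) * (hermiteEval i x * hermiteEval j x) :=
    fun x => by ring
  simp_rw [e]
  rw [integral_const_mul, integral_hermiteEval_mul_hermiteEval]
  split_ifs with h
  · subst h
    have : (0 : ℝ) < i.factorial := by positivity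
    rw [← mul_inv, Real.mul_self_sqrt this.le, inv_mul_cancel₀ this.ne']
  · simp

/-- The Hermite basis of `L²` of the standard Gaussian measure. -/
noncomputable def hermiteBasis : HilbertBasis ℕ ℝ (Lp ℝ 2 (gaussianReal 0 1)) :=
  HilbertBasis.mkOfOrthogonalEqBot orthonormal_normalizedHermite <| by
    rw [Submodule.eq_bot_iff]
    intro f hf
    have hfm := Lp.memLp f
    have h0 : (f : ℝ → ℝ) =ᵐ[gaussianReal 0 1] 0 := by
      refine ae_eq_zero_of_hermiteCoeff_eq_zero hfm fun k => ?_
      have h1 := (Submodule.mem_orthogonal _ _).1 hf _ (Submodule.subset_span ⟨k, rfl⟩)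
      have h2 := inner_normalizedHermite_toLp hfm k
      rw [Lp.toLp_coeFn, h1] at h2
      have h3 : (√(k.factorial : ℝ))⁻¹ ≠ 0 := by positivity
      exact (mul_eq_zero.1 h2.symm).resolve_left h3
    exact (Lp.eq_zero_iff_ae_eq_zero).2 h0

theorem hermiteBasis_apply (k : ℕ) : hermiteBasis k = normalizedHermite k := by
  simp [hermiteBasis]

theorem memLp_comp_of_map_eq {Ω : Type*} [MeasurableSpace Ω] {P : Measure Ω} {Z : Ω → ℝ} (hZm : AEMeasurable Z P)
    (hZ : P.map Z = gaussianReal 0 1) {g : ℝ → ℝ} (hg : MemLp g 2 (gaussianReal 0 1)) :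
    MemLp (fun ω => g (Z ω)) 2 P := by
  have h1 : MemLp g 2 (P.map Z) := by rw [hZ]; exact hg
  exact (memLp_map_measure_iff h1.aestronglyMeasurable hZm).1 h1

/-! ### Functions of two correlated standard Gaussian variables. -/

section Pair

variable {Ω : Type*} [MeasurableSpace Ω] {P : Measure Ω} [IsProbabilityMeasure P] {X Y : Ω → ℝ}

/-- The residual of the regression of `Y` on `X` is uncorrelated with `X` and jointly Gaussian with
it, hence independent. The degenerate case `v = 0` of perfect correlation is allowed. -/
theorem map_prodMk_sub_mul (hXY : HasGaussianLaw (fun ω => (X ω, Y ω)) P)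
    (hX : P.map X = gaussianReal 0 1) (hY : P.map Y = gaussianReal 0 1) :
    ∃ v : NNReal, (v : ℝ) = 1 - cov[X, Y; P] ^ 2 ∧
      P.map (fun ω => (X ω, Y ω - cov[X, Y; P] * X ω))
        = (gaussianReal 0 1).prod (gaussianReal 0 v) := by
  set ρ := cov[X, Y; P] with hρ
  have hXm : AEMeasurable X P := hXY.fst.aemeasurable
  have hYm : AEMeasurable Y P := hXY.snd.aemeasurable
  have hX2 := hXY.fst.memLp_two
  have hY2 := hXY.snd.memLp_two
  have vX : Var[X; P] = 1 := by
    have := variance_map (Y := X) (X := id) (μ := P) (by fun_prop) hXm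
    rw [hX, variance_id_gaussianReal] at this
    simpa using this.symm
  have vY : Var[Y; P] = 1 := by
    have := variance_map (Y := Y) (X := id) (μ := P) (by fun_prop) hYm
    rw [hY, variance_id_gaussianReal] at this
    simpa using this.symm
  have mX : ∫ ω, X ω ∂P = 0 := by
    have := integral_map (f := fun x : ℝ => x) hXm (by fun_prop)
    rw [hX, integral_id_gaussianReal] at this
    exact this.symm
  have mY : ∫ ω, Y ω ∂P = 0 := by
    have := integral_map (f := fun x : ℝ => x) hYm (by fun_prop)
    rw [hY, integral_id_gaussianReal] at this
    exact this.symm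
  set Z : Ω → ℝ := fun ω => Y ω - ρ * X ω with hZ
  have hXZ : HasGaussianLaw (fun ω => (X ω, Z ω)) P := by
    have := hXY.map_fun ((ContinuousLinearMap.fst ℝ ℝ ℝ).prod
      (ContinuousLinearMap.snd ℝ ℝ ℝ - ρ • ContinuousLinearMap.fst ℝ ℝ ℝ))
    simpa [hZ] using this
  have hρX : MemLp (fun ω => ρ * X ω) 2 P := hX2.const_mul ρ
  have cXZ : cov[X, Z; P] = 0 := by
    have : cov[X, Z; P] = cov[X, Y; P] - cov[X, fun ω => ρ * X ω; P] :=
      covariance_sub_right hX2 hY2 hρX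
    rw [this, covariance_const_mul_right, covariance_self hXm, vX, ← hρ]
    ring
  have hZm : AEMeasurable Z P := hXZ.snd.aemeasurable
  have vZ : Var[Z; P] = 1 - ρ ^ 2 := by
    have : Var[Z; P] = Var[Y; P] - 2 * cov[Y, fun ω => ρ * X ω; P] + Var[fun ω => ρ * X ω; P] :=
      variance_sub hY2 hρX
    rw [this, covariance_const_mul_right, variance_const_mul, vX, vY, covariance_comm, ← hρ]
    ring
  have mZ : ∫ ω, Z ω ∂P = 0 := by
    rw [hZ, integral_sub (hY2.integrable (by norm_num)) (hρX.integrable (by norm_num)),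
      integral_const_mul, mX, mY]
    simp
  refine ⟨Var[Z; P].toNNReal, ?_, ?_⟩
  · rw [Real.coe_toNNReal _ (variance_nonneg _ _), vZ]
  · have hind := hXZ.indepFun_of_covariance_eq_zero cXZ
    rw [indepFun_iff_map_prod_eq_prod_map_map hXm hZm] at hind
    rw [hind, hX, hXZ.snd.map_eq_gaussianReal, mZ]

/-- Correlation of a function of `X` with a Hermite polynomial of `Y`. -/
theorem integral_comp_mul_hermiteEval_comp (hXY : HasGaussianLaw (fun ω => (X ω, Y ω)) P)
    (hX : P.map X = gaussianReal 0 1) (hY : P.map Y = gaussianReal 0 1)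
    {f : ℝ → ℝ} (hf : MemLp f 2 (gaussianReal 0 1)) (k : ℕ) :
    ∫ ω, f (X ω) * hermiteEval k (Y ω) ∂P = cov[X, Y; P] ^ k * hermiteCoeff f k := by
  obtain ⟨v, hv, hmap⟩ := map_prodMk_sub_mul hXY hX hY
  set ρ := cov[X, Y; P]
  have hXm : AEMeasurable X P := hXY.fst.aemeasurable
  have hYm : AEMeasurable Y P := hXY.snd.aemeasurable
  have hZm : AEMeasurable (fun ω => (X ω, Y ω - ρ * X ω)) P := by fun_prop
  have hF : AEStronglyMeasurable (fun p : ℝ × ℝ => f p.1 * hermiteEval k (ρ * p.1 + p.2))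
      ((gaussianReal 0 1).prod (gaussianReal 0 v)) :=
    hf.aestronglyMeasurable.comp_fst.mul
      ((continuous_hermiteEval k).comp (by fun_prop)).aestronglyMeasurable
  have e : ∀ ω, f (X ω) * hermiteEval k (Y ω)
      = (fun p : ℝ × ℝ => f p.1 * hermiteEval k (ρ * p.1 + p.2)) (X ω, Y ω - ρ * X ω) :=
    fun ω => by simp
  have hfX : MemLp (fun ω => f (X ω)) 2 P := memLp_comp_of_map_eq hXm hX hf
  have hHY : MemLp (fun ω => hermiteEval k (Y ω)) 2 P :=
    memLp_comp_of_map_eq hYm hY (memLp_hermiteEval k 2 (by simp))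
  have hint : Integrable (fun p : ℝ × ℝ => f p.1 * hermiteEval k (ρ * p.1 + p.2))
      ((gaussianReal 0 1).prod (gaussianReal 0 v)) := by
    rw [← hmap, integrable_map_measure (by rw [hmap]; exact hF) hZm]
    refine (hfX.integrable_mul hHY).congr (ae_of_all _ fun ω => ?_)
    exact e ω
  rw [integral_congr_ae (ae_of_all _ e)]
  refine (integral_map hZm (by rw [hmap]; exact hF)).symm.trans ?_
  rw [hmap, integral_prod _ hint, hermiteCoeff,
    ← integral_const_mul]
  congr 1; ext x
  simp only
  rw [integral_const_mul, integral_hermiteEval_mehler ρ v hv]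
  ring

/-- **Gebelein's inequality**: functions of Hermite rank at least `m` of two standard Gaussian
variables with correlation `ρ ≥ 0` have covariance at most of order `ρ ^ m`. -/
theorem abs_integral_comp_mul_comp_le (hXm : Measurable X) (hYm : Measurable Y)
    (hXY : HasGaussianLaw (fun ω => (X ω, Y ω)) P)
    (hX : P.map X = gaussianReal 0 1) (hY : P.map Y = gaussianReal 0 1)
    (h0 : 0 ≤ cov[X, Y; P]) (h1 : cov[X, Y; P] ≤ 1)
    {f : ℝ → ℝ} (hf : MemLp f 2 (gaussianReal 0 1)) {m : ℕ}
    (hm : ∀ j < m, hermiteCoeff f j = 0) :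
    |∫ ω, f (X ω) * f (Y ω) ∂P| ≤ cov[X, Y; P] ^ m * ∫ x, f x ^ 2 ∂(gaussianReal 0 1) := by
  have hYX : HasGaussianLaw (fun ω => (Y ω, X ω)) P := by
    simpa using hXY.map_fun ((ContinuousLinearMap.snd ℝ ℝ ℝ).prod
      (ContinuousLinearMap.fst ℝ ℝ ℝ))
  set ρ := cov[X, Y; P] with hρ
  have mpX : MeasurePreserving X P (gaussianReal 0 1) := ⟨hXm, hX⟩
  have mpY : MeasurePreserving Y P (gaussianReal 0 1) := ⟨hYm, hY⟩
  -- Composition with `X` or `Y` embeds `L²` of the Gaussian measure isometrically in `L²(P)`, so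
  -- the Hermite expansion of `f` can be inserted in the inner product.
  let UX := Lp.compMeasurePreservingₗᵢ (E := ℝ) (p := 2) ℝ X mpX
  let UY := Lp.compMeasurePreservingₗᵢ (E := ℝ) (p := 2) ℝ Y mpY
  have hUX {g : ℝ → ℝ} (hg : MemLp g 2 (gaussianReal 0 1)) :
      UX (hg.toLp g) = (hg.comp_measurePreserving mpX).toLp _ := rfl
  have hUY {g : ℝ → ℝ} (hg : MemLp g 2 (gaussianReal 0 1)) :
      UY (hg.toLp g) = (hg.comp_measurePreserving mpY).toLp _ := rfl
  set F := hf.toLp f with hF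
  have hI : inner ℝ (UY F) (UX F) = ∫ ω, f (X ω) * f (Y ω) ∂P := by
    rw [hF, hUX, hUY, inner_toLp_toLp]
    simp [mul_comm]
  set c : ℕ → ℝ := fun k => hermiteBasis.repr F k with hc
  have hck (k : ℕ) : c k = (√k.factorial)⁻¹ * hermiteCoeff f k := by
    rw [hc]
    simp only
    rw [HilbertBasis.repr_apply_apply, hermiteBasis_apply, hF, inner_normalizedHermite_toLp]
  have hb (k : ℕ) : inner ℝ (UY F) (UX (hermiteBasis k)) = ρ ^ k * c k := by
    rw [hermiteBasis_apply, normalizedHermite, hUX, hF, hUY, inner_toLp_toLp, hck]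
    have := integral_comp_mul_hermiteEval_comp hYX hY hX hf k
    rw [covariance_comm, ← hρ] at this
    rw [mul_left_comm, ← this, ← integral_const_mul]
    refine integral_congr_ae (ae_of_all _ fun ω => ?_)
    simp only [Function.comp_apply]
    ring
  have hsum : HasSum (fun k => ρ ^ k * c k ^ 2) (∫ ω, f (X ω) * f (Y ω) ∂P) := by
    have h := ((hermiteBasis.hasSum_repr F).mapL UX.toContinuousLinearMap).mapL
      (innerSL ℝ (UY F))
    simp only [innerSL_apply_apply, map_smul, LinearIsometry.coe_toContinuousLinearMap, hb,
      smul_eq_mul, hI] at h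
    refine h.congr_fun fun k => ?_
    simp only [hc]
    ring
  have hpars : HasSum (fun k => c k ^ 2) (∫ x, f x ^ 2 ∂(gaussianReal 0 1)) := by
    have h := hermiteBasis.hasSum_inner_mul_inner F F
    rw [hF, inner_toLp_toLp] at h
    simp only [← pow_two] at h
    refine h.congr_fun fun k => ?_
    rw [real_inner_comm, ← pow_two, ← HilbertBasis.repr_apply_apply]
  -- The series of `ρ ^ k * c k ^ 2` is compared with Parseval's: terms with `k < m` vanish, and `ρ
  -- ^ k ≤ ρ ^ m` for the others.
  have hle : ∫ ω, f (X ω) * f (Y ω) ∂P ≤ ρ ^ m * ∫ x, f x ^ 2 ∂(gaussianReal 0 1) := by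
    refine hasSum_le (fun k => ?_) hsum (hpars.mul_left (ρ ^ m))
    rcases lt_or_ge k m with hk | hk
    · rw [hck, hm k hk]; simp
    · exact mul_le_mul_of_nonneg_right (pow_le_pow_of_le_one h0 h1 hk) (sq_nonneg _)
  rwa [abs_of_nonneg (hsum.nonneg fun k => by positivity)]

end Pair

/-! ### Slowly varying functions -/

/-- A continuous function whose increments over every fixed step tend to zero has uniformly bounded
increments over unit intervals near infinity. -/
theorem exists_abs_sub_le_of_tendsto_add_sub {h : ℝ → ℝ} (hc : Continuous h)
    (hu : ∀ u, Tendsto (fun x => h (x + u) - h x) atTop (𝓝 0)) :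
    ∃ A B : ℝ, ∀ y ≥ A, ∀ v ∈ Set.Icc (0 : ℝ) 1, |h (y + v) - h y| ≤ B := by
  -- Baire category: these closed sets cover the line, so one of them contains a ball. Continuity of
  -- `h` is what makes them closed.
  let F : ℕ → Set ℝ := fun n => {u | ∀ x : ℝ, n ≤ x → |h (x + u) - h x| ≤ 1}
  have hF : ∀ n, IsClosed (F n) := fun n => by
    simp only [F, Set.ofPred_forall]
    exact isClosed_iInter fun x => isClosed_iInter fun _ =>
      isClosed_le (by fun_prop) continuous_const
  have hU : ⋃ n, F n = Set.univ := by
    refine Set.eq_univ_of_forall fun u => Set.mem_iUnion.2 ?_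
    obtain ⟨N, hN⟩ := eventually_atTop.1 ((hu u).eventually (Metric.ball_mem_nhds 0 one_pos))
    obtain ⟨n, hn⟩ := exists_nat_ge N
    refine ⟨n, fun x hx => ?_⟩
    have := hN x (hn.trans hx)
    rw [dist_zero_right, Real.norm_eq_abs] at this
    exact this.le
  obtain ⟨n, u, hint⟩ := nonempty_interior_of_iUnion_of_closed hF hU
  obtain ⟨ε, hε, hball⟩ := Metric.mem_nhds_iff.1 (mem_interior_iff_mem_nhds.1 hint)
  have hu0 : u ∈ F n := hball (Metric.mem_ball_self hε)
  -- A short increment from `y` is the difference of two increments from `y - u`, with steps `u + w`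
  -- and `u`, both in the ball.
  have step (y : ℝ) (hy : n + u ≤ y) (w : ℝ) (hw : |w| < ε) : |h (y + w) - h y| ≤ 2 := by
    have h1 : |h (y - u + u) - h (y - u)| ≤ 1 := hu0 (y - u) (by linarith)
    have h2 : |h (y - u + (u + w)) - h (y - u)| ≤ 1 := by
      refine hball ?_ (y - u) (by linarith)
      simpa [Metric.mem_ball, Real.dist_eq] using hw
    rw [sub_add_cancel] at h1
    rw [show y - u + (u + w) = y + w by ring] at h2
    rw [abs_le] at *
    constructor <;> linarith
  have steps (w : ℝ) (hw0 : 0 ≤ w) (hw : |w| < ε) (k : ℕ) (y : ℝ) (hy : n + u ≤ y) :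
      |h (y + k * w) - h y| ≤ 2 * k := by
    induction k with
    | zero => simp
    | succ k ih =>
      have h1 := step (y + k * w) (by nlinarith [mul_nonneg k.cast_nonneg hw0]) w hw
      push_cast
      rw [show y + (k + 1) * w = y + k * w + w by ring]
      rw [abs_le] at *
      constructor <;> linarith
  obtain ⟨M, hM⟩ := exists_nat_one_div_lt hε
  refine ⟨n + u, 2 * (M + 1 : ℕ), fun y hy v hv => ?_⟩
  have hM0 : (0 : ℝ) < M + 1 := by positivity
  have := steps (v / (M + 1)) (div_nonneg hv.1 hM0.le) (by
    rw [abs_of_nonneg (div_nonneg hv.1 hM0.le)]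
    exact (div_le_div_of_nonneg_right hv.2 hM0.le).trans_lt hM) (M + 1) y hy
  rwa [Nat.cast_succ, mul_div_cancel₀ _ hM0.ne', ← Nat.cast_succ] at this

/-- Unit increments are eventually below `δ / 2`; telescoping them, with the bounded increment over
the last fractional step, gives growth at rate `δ / 2` up to a constant that is absorbed for large
`x`. -/
theorem eventually_abs_le_mul_of_tendsto_add_sub {h : ℝ → ℝ} (hc : Continuous h)
    (hu : ∀ u, Tendsto (fun x => h (x + u) - h x) atTop (𝓝 0)) {δ : ℝ} (hδ : 0 < δ) :
    ∀ᶠ x in atTop, |h x| ≤ δ * x := by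
  obtain ⟨A, B, hAB⟩ := exists_abs_sub_le_of_tendsto_add_sub hc hu
  obtain ⟨N, hN⟩ := eventually_atTop.1
    ((hu 1).eventually (Metric.ball_mem_nhds 0 (half_pos hδ)))
  set a := max (max A N) 0
  have haA : A ≤ a := (le_max_left _ _).trans (le_max_left _ _)
  have haN : N ≤ a := (le_max_right _ _).trans (le_max_left _ _)
  have ha0 : 0 ≤ a := le_max_right _ _
  have steps (k : ℕ) : |h (a + k) - h a| ≤ δ / 2 * k := by
    induction k with
    | zero => simp
    | succ k ih =>
      have h1 := hN (a + k) (by linarith [k.cast_nonneg (α := ℝ)])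
      rw [dist_zero_right, Real.norm_eq_abs] at h1
      push_cast
      rw [← add_assoc]
      rw [abs_lt] at h1
      rw [abs_le] at *
      constructor <;> linarith
  filter_upwards [eventually_ge_atTop a, eventually_ge_atTop (2 * (|h a| + B) / δ)] with x hx hx'
  have hk1 := Nat.floor_le (sub_nonneg.2 hx)
  have hk2 := Nat.lt_floor_add_one (x - a)
  set k := ⌊x - a⌋₊
  have h1 := steps k
  have h2 := hAB (a + k) (by linarith [k.cast_nonneg (α := ℝ)]) (x - a - k)
    ⟨by linarith, by linarith⟩
  rw [show a + k + (x - a - k) = x by ring] at h2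
  rw [div_le_iff₀ hδ] at hx'
  have h3 : |h x| ≤ |h a| + |h (a + k) - h a| + |h x - h (a + k)| := by
    calc |h x| = |h a + (h (a + k) - h a) + (h x - h (a + k))| := by ring_nf
      _ ≤ _ := (abs_add_le _ _).trans (add_le_add_left (abs_add_le _ _) _)
  have h4 : δ / 2 * k ≤ δ / 2 * x := by gcongr; linarith
  linarith

/-- A continuous slowly varying function is eventually between `t ^ (-δ)` and `t ^ δ`. -/
theorem IsSlowlyVarying.eventually_rpow_le {L : ℝ → ℝ} (hL : IsSlowlyVarying L)
    (hc : ContinuousOn L (Set.Ioi 0)) {δ : ℝ} (hδ : 0 < δ) :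
    ∀ᶠ t in atTop, t ^ (-δ) ≤ L t ∧ L t ≤ t ^ δ := by
  -- In logarithmic coordinates slow variation says that increments over fixed steps tend to zero.
  have hcont : Continuous fun x => Real.log (L (Real.exp x)) := by
    refine Continuous.log (hc.comp_continuous Real.continuous_exp fun x => Real.exp_pos x)
      fun x => (hL.pos _ (Real.exp_pos x)).ne'
  have hu (u : ℝ) : Tendsto (fun x => Real.log (L (Real.exp (x + u)))
      - Real.log (L (Real.exp x))) atTop (𝓝 0) := by
    have h1 := ((hL.tendsto (Real.exp u) (Real.exp_pos u)).comp Real.tendsto_exp_atTop).log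
      one_ne_zero
    rw [Real.log_one] at h1
    refine h1.congr fun x => ?_
    simp only [Function.comp]
    rw [← Real.exp_add, Real.log_div (hL.pos _ (Real.exp_pos _)).ne'
      (hL.pos _ (Real.exp_pos _)).ne']
  have h := Real.tendsto_log_atTop.eventually
    (eventually_abs_le_mul_of_tendsto_add_sub hcont hu hδ)
  filter_upwards [h, eventually_gt_atTop 0] with t ht ht0
  rw [Real.exp_log ht0, abs_le] at ht
  rw [Real.rpow_def_of_pos ht0, Real.rpow_def_of_pos ht0, ← Real.le_log_iff_exp_le (hL.pos t ht0),
    ← Real.log_le_iff_le_exp (hL.pos t ht0)]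
  constructor <;> linarith

theorem IsSlowlyVarying.tendsto_rpow_neg_mul {L : ℝ → ℝ} (hL : IsSlowlyVarying L)
    (hc : ContinuousOn L (Set.Ioi 0)) {α : ℝ} (hα : 0 < α) :
    Tendsto (fun t => t ^ (-α) * L t) atTop (𝓝 0) := by
  refine squeeze_zero' (g := fun t => t ^ (-(α / 2))) ?_ ?_
    (tendsto_rpow_neg_atTop (half_pos hα))
  · filter_upwards [eventually_gt_atTop 0] with t ht
    exact mul_nonneg (Real.rpow_nonneg ht.le _) (hL.pos t ht).le
  · filter_upwards [hL.eventually_rpow_le hc (half_pos hα), eventually_gt_atTop 0] with t h ht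
    calc t ^ (-α) * L t ≤ t ^ (-α) * t ^ (α / 2) := by
          gcongr; exact h.2
      _ = t ^ (-(α / 2)) := by rw [← Real.rpow_add ht]; congr 1; ring

/-- Applied to the covariance, this makes `L₀` continuous, as the Baire argument requires. -/
theorem continuousOn_of_eq_rpow_neg_mul {L g : ℝ → ℝ} {α : ℝ} (hg : ContinuousOn g (Set.Ioi 0))
    (hgL : ∀ t, 0 < t → g t = t ^ (-α) * L t) : ContinuousOn L (Set.Ioi 0) := by
  have h1 : ContinuousOn (fun t => t ^ α * g t) (Set.Ioi 0) :=
    (continuousOn_id.rpow_const fun t ht => Or.inl (ne_of_gt ht)).mul hg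
  refine h1.congr fun t ht => ?_
  simp only
  rw [hgL t ht, ← mul_assoc, ← Real.rpow_add ht]
  simp

/-- A positive continuous function on `[0,∞)` that varies regularly with index `-α` is bounded
below by a multiple of `(1 + t) ^ (-β)` for every `β > α`. -/
theorem exists_mul_rpow_le_of_isSlowlyVarying {L g : ℝ → ℝ} (hL : IsSlowlyVarying L)
    (hg : ContinuousOn g (Set.Ici 0)) (hpos : ∀ t, 0 ≤ t → 0 < g t) {α β : ℝ} (hα : 0 < α)
    (hβ : α < β) (hgL : ∀ t, 0 < t → g t = t ^ (-α) * L t) :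
    ∃ c : ℝ, 0 < c ∧ ∀ t, 0 ≤ t → c * (1 + t) ^ (-β) ≤ g t := by
  have hc := continuousOn_of_eq_rpow_neg_mul (hg.mono Set.Ioi_subset_Ici_self) hgL
  obtain ⟨T, hT⟩ := eventually_atTop.1 (hL.eventually_rpow_le hc (sub_pos.2 hβ))
  set T' := max T 1
  -- On `[0, T']` the lower bound comes from compactness and positivity; beyond `T'` it comes from
  -- `L t ≥ t ^ (-(β - α))`.
  have hT'1 : 1 ≤ T' := le_max_right _ _
  obtain ⟨t₀, ht₀, hmin⟩ := (isCompact_Icc (a := (0 : ℝ)) (b := T')).exists_isMinOn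
    ⟨0, by simp; linarith⟩ (hg.mono Set.Icc_subset_Ici_self)
  refine ⟨min (g t₀) 1, lt_min (hpos _ ht₀.1) one_pos, fun t ht => ?_⟩
  have h1t : (1 : ℝ) ≤ 1 + t := by linarith
  have hle1 : (1 + t) ^ (-β) ≤ 1 := Real.rpow_le_one_of_one_le_of_nonpos h1t (by linarith)
  have hnn : 0 ≤ (1 + t) ^ (-β) := Real.rpow_nonneg (by linarith) _
  rcases le_total t T' with h | h
  · calc min (g t₀) 1 * (1 + t) ^ (-β) ≤ g t₀ * 1 :=
          mul_le_mul (min_le_left _ _) hle1 hnn (hpos _ ht₀.1).le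
      _ ≤ g t := by rw [mul_one]; exact hmin ⟨ht, h⟩
  · have ht0 : 0 < t := by linarith
    calc min (g t₀) 1 * (1 + t) ^ (-β) ≤ 1 * (1 + t) ^ (-β) :=
          mul_le_mul_of_nonneg_right (min_le_right _ _) hnn
      _ ≤ t ^ (-β) := by
          rw [one_mul]
          exact Real.rpow_le_rpow_of_nonpos ht0 (by linarith) (by linarith)
      _ = t ^ (-α) * t ^ (-(β - α)) := by rw [← Real.rpow_add ht0]; congr 1; ring
      _ ≤ g t := by
          rw [hgL t ht0]
          gcongr
          exact (hT t ((le_max_left _ _).trans h)).1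

/-! ### The covariance of the field -/

theorem sq_integral_mul_le {α : Type*} [MeasurableSpace α] {μ : Measure α} {f g : α → ℝ}
    (hf : MemLp f 2 μ) (hg : MemLp g 2 μ) :
    (∫ x, f x * g x ∂μ) ^ 2 ≤ (∫ x, f x ^ 2 ∂μ) * ∫ x, g x ^ 2 ∂μ := by
  have h := real_inner_mul_inner_self_le (hf.toLp f) (hg.toLp g)
  simpa only [inner_toLp_toLp, ← pow_two] using h

section Field

variable {d : ℕ} {Ω : Type*} [MeasurableSpace Ω] {P : Measure Ω}
  {η : EuclideanSpace ℝ (Fin d) → Ω → ℝ} {α : ℝ} {L₀ : ℝ → ℝ}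

theorem IsHomogeneousIsotropicGaussianField.measurable_apply
    (h : IsHomogeneousIsotropicGaussianField η P) (x : EuclideanSpace ℝ (Fin d)) :
    Measurable (η x) := h.measurable.of_uncurry_left

theorem IsHomogeneousIsotropicGaussianField.memLp
    (h : IsHomogeneousIsotropicGaussianField η P) (x : EuclideanSpace ℝ (Fin d)) :
    MemLp (η x) 2 P := (h.gaussian.hasGaussianLaw_eval x).memLp_two

variable [IsProbabilityMeasure P]

theorem IsHomogeneousIsotropicGaussianField.covariance_eq_integral
    (h : IsHomogeneousIsotropicGaussianField η P) (x y : EuclideanSpace ℝ (Fin d)) :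
    cov[η x, η y; P] = ∫ ω, η x ω * η y ω ∂P := by
  rw [covariance_eq_sub (h.memLp x) (h.memLp y), h.mean_zero, h.mean_zero]
  simp

theorem HasRegularlyVaryingCovariance.covariance_self (h : HasRegularlyVaryingCovariance η P α L₀)
    (x : EuclideanSpace ℝ (Fin d)) : cov[η x, η x; P] = 1 := by
  rw [h.field.covariance_eq x x 0 0 (by simp), h.field.covariance_eq_integral, h.variance_one]

theorem HasRegularlyVaryingCovariance.map_eq (h : HasRegularlyVaryingCovariance η P α L₀)
    (x : EuclideanSpace ℝ (Fin d)) : P.map (η x) = gaussianReal 0 1 := by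
  rw [(h.field.gaussian.hasGaussianLaw_eval x).map_eq_gaussianReal, h.field.mean_zero,
    ← ProbabilityTheory.covariance_self (h.field.measurable_apply x).aemeasurable,
    h.covariance_self, Real.toNNReal_one]

theorem HasRegularlyVaryingCovariance.covariance_le_one
    (h : HasRegularlyVaryingCovariance η P α L₀) (x y : EuclideanSpace ℝ (Fin d)) :
    cov[η x, η y; P] ≤ 1 := by
  have hv := variance_nonneg (η x - η y) P
  rw [variance_sub (h.field.memLp x) (h.field.memLp y),
    ← ProbabilityTheory.covariance_self (h.field.measurable_apply x).aemeasurable,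
    ← ProbabilityTheory.covariance_self (h.field.measurable_apply y).aemeasurable,
    h.covariance_self, h.covariance_self] at hv
  linarith

/-- The covariance of the field is a positive continuous function of the distance. -/
theorem HasRegularlyVaryingCovariance.exists_correlation
    (h : HasRegularlyVaryingCovariance η P α L₀) (hd : 0 < d) :
    ∃ ρ : ℝ → ℝ, Continuous ρ ∧ (∀ t, 0 ≤ t → 0 < ρ t) ∧ (∀ t, ρ t ≤ 1) ∧
      (∀ t, 0 < t → ρ t = t ^ (-α) * L₀ t) ∧
      ∀ x y, cov[η x, η y; P] = ρ (dist x y) := by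
  let e : EuclideanSpace ℝ (Fin d) := EuclideanSpace.single ⟨0, hd⟩ 1
  have he : ‖e‖ = 1 := by simp [e]
  let ρ : ℝ → ℝ := fun t => cov[η 0, η (t • e); P]
  have hpos (t : ℝ) (ht : 0 < t) : ρ t = t ^ (-α) * L₀ t := by
    have hne : t • e ≠ 0 := by
      rw [← norm_ne_zero_iff, norm_smul, he, mul_one, norm_ne_zero_iff]; exact ht.ne'
    have hn : ‖t • e‖ = t := by rw [norm_smul, he, mul_one, Real.norm_of_nonneg ht.le]
    have := h.covariance (t • e) hne
    rw [hn] at this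
    simp only [ρ]
    rw [h.field.covariance_eq_integral, this]
  refine ⟨ρ, ?_, ?_, fun t => h.covariance_le_one _ _, hpos, fun x y => ?_⟩
  · rw [continuous_iff_continuousAt]
    intro t
    -- By Cauchy–Schwarz and unit variance, the squared increment of `ρ` is at most the mean-square
    -- increment of the field along the ray.
    have hsq : Tendsto (fun s => (ρ s - ρ t) ^ 2) (𝓝 t) (𝓝 0) := by
      have hms := (h.field.meanSquare_continuous (t • e)).comp
        ((continuous_id.smul continuous_const).tendsto' t (t • e) rfl : Tendsto (fun s : ℝ => s • e)
          (𝓝 t) (𝓝 (t • e)))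
      refine squeeze_zero (fun s => sq_nonneg _) (fun s => ?_) hms
      simp only [ρ, h.field.covariance_eq_integral]
      rw [← integral_sub]
      · have hd2 : MemLp (fun ω => η (s • e) ω - η (t • e) ω) 2 P :=
          (h.field.memLp _).sub (h.field.memLp _)
        have := sq_integral_mul_le (h.field.memLp 0) hd2
        have h1 : ∫ ω, η 0 ω ^ 2 ∂P = 1 := by simpa only [pow_two] using h.variance_one
        rw [h1, one_mul] at this
        simp only [mul_sub] at this
        exact this
      · exact (h.field.memLp 0).integrable_mul (h.field.memLp _)
      · exact (h.field.memLp 0).integrable_mul (h.field.memLp _)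
    have habs : Tendsto (fun s => |ρ s - ρ t|) (𝓝 t) (𝓝 0) := by
      simpa [Real.sqrt_sq_eq_abs] using hsq.sqrt
    exact tendsto_sub_nhds_zero_iff.1 (tendsto_zero_iff_abs_tendsto_zero _ |>.2 habs)
  · intro t ht
    rcases ht.eq_or_lt with rfl | ht
    · simp only [ρ, zero_smul]
      rw [h.covariance_self]
      exact one_pos
    · rw [hpos t ht]
      exact mul_pos (Real.rpow_pos_of_pos ht _) (h.slowlyVarying.pos t ht)
  · refine h.field.covariance_eq _ _ _ _ ?_
    rw [dist_zero_left, norm_smul, he, mul_one, Real.norm_of_nonneg dist_nonneg]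

/-! ### Second moments of integral functionals of the field -/

theorem HasRegularlyVaryingCovariance.memLp_comp (h : HasRegularlyVaryingCovariance η P α L₀)
    {f : ℝ → ℝ} (hf : MemLp f 2 (gaussianReal 0 1)) (x : EuclideanSpace ℝ (Fin d)) :
    MemLp (fun ω => f (η x ω)) 2 P :=
  memLp_comp_of_map_eq (h.field.measurable_apply x).aemeasurable (h.map_eq x) hf

theorem HasRegularlyVaryingCovariance.integral_comp (h : HasRegularlyVaryingCovariance η P α L₀)
    {f : ℝ → ℝ} (hf : AEStronglyMeasurable f (gaussianReal 0 1))
    (x : EuclideanSpace ℝ (Fin d)) :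
    ∫ ω, f (η x ω) ∂P = ∫ w, f w ∂(gaussianReal 0 1) := by
  rw [← h.map_eq x, integral_map (h.field.measurable_apply x).aemeasurable]
  rwa [h.map_eq x]

/-- As `f` is only almost everywhere measurable, the evaluation map must pull Gaussian null sets
back to null sets. By Fubini this holds because every `η x` is standard Gaussian. -/
theorem HasRegularlyVaryingCovariance.aestronglyMeasurable_comp
    (h : HasRegularlyVaryingCovariance η P α L₀) {T : Type*} [MeasurableSpace T] (ν : Measure T)
    [SFinite ν] {π : T → EuclideanSpace ℝ (Fin d)} (hπ : Measurable π) {f : ℝ → ℝ}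
    (hf : AEStronglyMeasurable f (gaussianReal 0 1)) :
    AEStronglyMeasurable (fun p : T × Ω => f (η (π p.1) p.2)) (ν.prod P) := by
  have hm : Measurable fun p : T × Ω => η (π p.1) p.2 :=
    h.field.measurable.comp ((hπ.comp measurable_fst).prodMk measurable_snd)
  refine hf.comp_quasiMeasurePreserving ⟨hm, ?_⟩
  refine Measure.AbsolutelyContinuous.mk fun s hs h0 => ?_
  rw [Measure.map_apply hm hs, Measure.measure_prod_null (hm hs)]
  refine ae_of_all _ fun t => ?_
  have := Measure.map_apply (μ := P) (h.field.measurable_apply (π t)) hs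
  rw [h.map_eq, h0] at this
  exact this.symm

/-! ### Integrals of the field against a finite measure. -/

variable {μ : Measure (EuclideanSpace ℝ (Fin d))} [IsFiniteMeasure μ]

theorem HasRegularlyVaryingCovariance.integrable_comp_prod
    (h : HasRegularlyVaryingCovariance η P α L₀) {f : ℝ → ℝ} (hf : MemLp f 2 (gaussianReal 0 1)) :
    Integrable (fun p : EuclideanSpace ℝ (Fin d) × Ω => f (η p.1 p.2)) (μ.prod P) := by
  have hm : AEStronglyMeasurable (fun p : EuclideanSpace ℝ (Fin d) × Ω => f (η p.1 p.2))
      (μ.prod P) := h.aestronglyMeasurable_comp μ measurable_id hf.aestronglyMeasurable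
  rw [integrable_prod_iff hm]
  refine ⟨ae_of_all _ fun x => (h.memLp_comp hf x).integrable (by norm_num), ?_⟩
  have e (x : EuclideanSpace ℝ (Fin d)) :
      ∫ ω, ‖f (η x ω)‖ ∂P = ∫ w, ‖f w‖ ∂(gaussianReal 0 1) :=
    h.integral_comp (f := fun w => ‖f w‖) hf.aestronglyMeasurable.norm x
  simp only [e]
  exact integrable_const _

theorem HasRegularlyVaryingCovariance.ae_integrable_comp
    (h : HasRegularlyVaryingCovariance η P α L₀) {f : ℝ → ℝ} (hf : MemLp f 2 (gaussianReal 0 1)) :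
    ∀ᵐ ω ∂P, Integrable (fun x => f (η x ω)) μ :=
  (h.integrable_comp_prod hf).prod_left_ae

theorem HasRegularlyVaryingCovariance.integral_integral_comp
    (h : HasRegularlyVaryingCovariance η P α L₀) {f : ℝ → ℝ} (hf : MemLp f 2 (gaussianReal 0 1)) :
    ∫ ω, ∫ x, f (η x ω) ∂μ ∂P = μ.real Set.univ * ∫ w, f w ∂(gaussianReal 0 1) := by
  rw [← integral_integral_swap (h.integrable_comp_prod hf)]
  simp [h.integral_comp hf.aestronglyMeasurable]

theorem HasRegularlyVaryingCovariance.integrable_comp_mul_comp_prod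
    (h : HasRegularlyVaryingCovariance η P α L₀) {f g : ℝ → ℝ}
    (hf : MemLp f 2 (gaussianReal 0 1)) (hg : MemLp g 2 (gaussianReal 0 1)) :
    Integrable (fun q : (EuclideanSpace ℝ (Fin d) × EuclideanSpace ℝ (Fin d)) × Ω =>
      f (η q.1.1 q.2) * g (η q.1.2 q.2)) ((μ.prod μ).prod P) := by
  have hm : AEStronglyMeasurable
      (fun q : (EuclideanSpace ℝ (Fin d) × EuclideanSpace ℝ (Fin d)) × Ω =>
        f (η q.1.1 q.2) * g (η q.1.2 q.2)) ((μ.prod μ).prod P) :=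
    (h.aestronglyMeasurable_comp (μ.prod μ) measurable_fst hf.aestronglyMeasurable).mul
    (h.aestronglyMeasurable_comp (μ.prod μ) measurable_snd hg.aestronglyMeasurable)
  rw [integrable_prod_iff hm]
  refine ⟨ae_of_all _ fun p => (h.memLp_comp hf p.1).integrable_mul (h.memLp_comp hg p.2), ?_⟩
  refine Integrable.of_bound hm.norm.integral_prod_right'
    ((∫ w, f w ^ 2 ∂(gaussianReal 0 1)) + ∫ w, g w ^ 2 ∂(gaussianReal 0 1))
    (ae_of_all _ fun p => ?_)
  have if2 : Integrable (fun ω => f (η p.1 ω) ^ 2) P := (h.memLp_comp hf p.1).integrable_sq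
  have ig2 : Integrable (fun ω => g (η p.2 ω) ^ 2) P := (h.memLp_comp hg p.2).integrable_sq
  rw [Real.norm_of_nonneg (integral_nonneg fun ω => norm_nonneg _),
    ← h.integral_comp (f := fun w => f w ^ 2) hf.integrable_sq.aestronglyMeasurable p.1,
    ← h.integral_comp (f := fun w => g w ^ 2) hg.integrable_sq.aestronglyMeasurable p.2,
    ← integral_add if2 ig2]
  refine integral_mono
    ((h.memLp_comp hf p.1).integrable_mul (h.memLp_comp hg p.2)).norm (if2.add ig2) fun ω => ?_
  simp only [Real.norm_eq_abs, abs_mul]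
  nlinarith [sq_nonneg (|f (η p.1 ω)| - |g (η p.2 ω)|), sq_abs (f (η p.1 ω)), sq_abs (g (η p.2 ω)),
    abs_nonneg (f (η p.1 ω)), abs_nonneg (g (η p.2 ω)), sq_nonneg (|f (η p.1 ω)| + |g (η p.2 ω)|)]

theorem HasRegularlyVaryingCovariance.memLp_integral_comp
    (h : HasRegularlyVaryingCovariance η P α L₀) {f : ℝ → ℝ} (hf : MemLp f 2 (gaussianReal 0 1)) :
    MemLp (fun ω => ∫ x, f (η x ω) ∂μ) 2 P := by
  have hm : AEStronglyMeasurable (fun ω => ∫ x, f (η x ω) ∂μ) P :=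
    (h.aestronglyMeasurable_comp μ measurable_id hf.aestronglyMeasurable).prod_swap.integral_prod_right'
  rw [memLp_two_iff_integrable_sq hm]
  have hi := (h.integrable_comp_mul_comp_prod (μ := μ) hf hf).integral_prod_right
  refine hi.congr (ae_of_all _ fun ω => ?_)
  simp only
  rw [integral_prod_mul (fun x => f (η x ω)) (fun x => f (η x ω)), pow_two]

theorem HasRegularlyVaryingCovariance.integral_mul_integral_comp
    (h : HasRegularlyVaryingCovariance η P α L₀) {f g : ℝ → ℝ}
    (hf : MemLp f 2 (gaussianReal 0 1)) (hg : MemLp g 2 (gaussianReal 0 1)) :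
    ∫ ω, (∫ x, f (η x ω) ∂μ) * (∫ x, g (η x ω) ∂μ) ∂P
      = ∫ p, ∫ ω, f (η p.1 ω) * g (η p.2 ω) ∂P ∂(μ.prod μ) := by
  rw [integral_integral_swap (h.integrable_comp_mul_comp_prod hf hg)]
  refine integral_congr_ae (ae_of_all _ fun ω => ?_)
  exact (integral_prod_mul (fun x => f (η x ω)) (fun x => g (η x ω))).symm

end Field

/-! ### Variances of the functional and of its leading Hermite component -/

theorem hermiteCoeff_hermiteEval (k j : ℕ) :
    hermiteCoeff (hermiteEval k) j = if k = j then (j.factorial : ℝ) else 0 :=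
  (integral_hermiteEval_mul_hermiteEval k j).trans (by
    by_cases h : k = j <;> simp [h])

theorem hermiteCoeff_sub_mul {f g : ℝ → ℝ} (hf : MemLp f 2 (gaussianReal 0 1))
    (hg : MemLp g 2 (gaussianReal 0 1)) (c : ℝ) (j : ℕ) :
    hermiteCoeff (fun w => f w - c * g w) j = hermiteCoeff f j - c * hermiteCoeff g j := by
  have hj := memLp_hermiteEval j 2 (by simp)
  have i1 : Integrable (fun w => f w * hermiteEval j w) (gaussianReal 0 1) :=
    hf.integrable_mul hj
  have i2 : Integrable (fun w => c * (g w * hermiteEval j w)) (gaussianReal 0 1) :=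
    (hg.integrable_mul hj).const_mul c
  unfold hermiteCoeff
  rw [← integral_const_mul, ← integral_sub i1 i2]
  congr 1; ext w; ring

/-- The part of `G` of Hermite order larger than `κ`. -/
noncomputable def hermiteRemainder (G : ℝ → ℝ) (κ : ℕ) (w : ℝ) : ℝ :=
  G w - hermiteCoeff G κ / (κ.factorial : ℝ) * hermiteEval κ w

theorem HasHermiteRank.memLp_hermiteRemainder {G : ℝ → ℝ} {κ : ℕ} (hG : HasHermiteRank G κ) :
    MemLp (hermiteRemainder G κ) 2 (gaussianReal 0 1) :=
  hG.memLp.sub ((memLp_hermiteEval κ 2 (by simp)).const_mul _)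

theorem HasHermiteRank.hermiteCoeff_hermiteRemainder {G : ℝ → ℝ} {κ : ℕ}
    (hG : HasHermiteRank G κ) {j : ℕ} (hj : j < κ + 1) :
    hermiteCoeff (hermiteRemainder G κ) j = 0 := by
  unfold hermiteRemainder
  rw [hermiteCoeff_sub_mul hG.memLp (memLp_hermiteEval κ 2 (by simp)), hermiteCoeff_hermiteEval]
  rcases (Nat.lt_succ_iff.1 hj).eq_or_lt with rfl | h
  · have : (j.factorial : ℝ) ≠ 0 := by positivity
    simp [this]
  · rw [hG.coeff_eq_zero j h, if_neg h.ne']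
    simp

theorem HasHermiteRank.integral_eq_zero {G : ℝ → ℝ} {κ : ℕ} (hG : HasHermiteRank G κ) :
    ∫ w, G w ∂(gaussianReal 0 1) = 0 := by
  simpa [hermiteCoeff, hermiteEval_zero] using hG.coeff_eq_zero 0 hG.one_le

section Field

variable {d : ℕ} {Ω : Type*} [MeasurableSpace Ω] {P : Measure Ω} [IsProbabilityMeasure P]
  {η : EuclideanSpace ℝ (Fin d) → Ω → ℝ} {α : ℝ} {L₀ : ℝ → ℝ}
  {μ : Measure (EuclideanSpace ℝ (Fin d))} [IsFiniteMeasure μ]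

theorem HasRegularlyVaryingCovariance.continuous_covariance
    (h : HasRegularlyVaryingCovariance η P α L₀) (hd : 0 < d) :
    Continuous fun p : EuclideanSpace ℝ (Fin d) × EuclideanSpace ℝ (Fin d) =>
      cov[η p.1, η p.2; P] := by
  obtain ⟨ρ, hρ, -, -, -, hcov⟩ := h.exists_correlation hd
  simp only [hcov]
  fun_prop

theorem HasRegularlyVaryingCovariance.covariance_pos
    (h : HasRegularlyVaryingCovariance η P α L₀) (hd : 0 < d)
    (x y : EuclideanSpace ℝ (Fin d)) : 0 < cov[η x, η y; P] := by
  obtain ⟨ρ, -, hpos, -, -, hcov⟩ := h.exists_correlation hd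
  rw [hcov]
  exact hpos _ dist_nonneg

theorem HasRegularlyVaryingCovariance.integrable_covariance_pow
    (h : HasRegularlyVaryingCovariance η P α L₀) (hd : 0 < d) (k : ℕ) :
    Integrable (fun p : EuclideanSpace ℝ (Fin d) × EuclideanSpace ℝ (Fin d) =>
      cov[η p.1, η p.2; P] ^ k) (μ.prod μ) := by
  refine Integrable.of_bound ((h.continuous_covariance hd).pow k).aestronglyMeasurable 1
    (ae_of_all _ fun p => ?_)
  rw [norm_pow, Real.norm_of_nonneg (h.covariance_pos hd _ _).le]
  exact pow_le_one₀ (h.covariance_pos hd _ _).le (h.covariance_le_one _ _)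

theorem HasRegularlyVaryingCovariance.integral_mul_integral_hermiteEval
    (h : HasRegularlyVaryingCovariance η P α L₀) {f : ℝ → ℝ} (hf : MemLp f 2 (gaussianReal 0 1))
    (k : ℕ) :
    ∫ ω, (∫ x, f (η x ω) ∂μ) * (∫ x, hermiteEval k (η x ω) ∂μ) ∂P
      = (∫ p, cov[η p.1, η p.2; P] ^ k ∂(μ.prod μ)) * hermiteCoeff f k := by
  rw [h.integral_mul_integral_comp hf (memLp_hermiteEval k 2 (by simp)), ← integral_mul_const]
  refine integral_congr_ae (ae_of_all _ fun p => ?_)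
  exact integral_comp_mul_hermiteEval_comp h.field.gaussian.hasGaussianLaw_prodMk (h.map_eq _)
    (h.map_eq _) hf k

theorem HasRegularlyVaryingCovariance.integral_sq_integral_comp_le
    (h : HasRegularlyVaryingCovariance η P α L₀) (hd : 0 < d) {f : ℝ → ℝ}
    (hf : MemLp f 2 (gaussianReal 0 1)) {m : ℕ} (hm : ∀ j < m, hermiteCoeff f j = 0) :
    ∫ ω, (∫ x, f (η x ω) ∂μ) ^ 2 ∂P
      ≤ (∫ p, cov[η p.1, η p.2; P] ^ m ∂(μ.prod μ)) * ∫ w, f w ^ 2 ∂(gaussianReal 0 1) := by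
  simp only [pow_two (∫ _, _ ∂_)]
  rw [h.integral_mul_integral_comp hf hf, ← integral_mul_const]
  refine (Real.le_norm_self _).trans (norm_integral_le_of_norm_le
    ((h.integrable_covariance_pow hd m).mul_const _) (ae_of_all _ fun p => ?_))
  exact abs_integral_comp_mul_comp_le (h.field.measurable_apply _) (h.field.measurable_apply _)
    h.field.gaussian.hasGaussianLaw_prodMk (h.map_eq _) (h.map_eq _) (h.covariance_pos hd _ _).le
    (h.covariance_le_one _ _) hf hm

variable {G : ℝ → ℝ} {κ : ℕ}

theorem HasRegularlyVaryingCovariance.integral_integral_hermiteEval_eq_zero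
    (h : HasRegularlyVaryingCovariance η P α L₀) (hκ : 1 ≤ κ) :
    ∫ ω, ∫ x, hermiteEval κ (η x ω) ∂μ ∂P = 0 := by
  have h0 := hermiteCoeff_hermiteEval κ 0
  rw [if_neg (by omega)] at h0
  rw [h.integral_integral_comp (memLp_hermiteEval κ 2 (by simp))]
  simp only [hermiteCoeff, hermiteEval_zero, mul_one] at h0
  rw [h0, mul_zero]

theorem HasRegularlyVaryingCovariance.variance_integral_hermiteEval
    (h : HasRegularlyVaryingCovariance η P α L₀) (hκ : 1 ≤ κ) (c : ℝ) :
    Var[fun ω => c * ∫ x, hermiteEval κ (η x ω) ∂μ; P]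
      = c ^ 2 * κ.factorial * ∫ p, cov[η p.1, η p.2; P] ^ κ ∂(μ.prod μ) := by
  have hm := memLp_hermiteEval κ 2 (by simp)
  rw [variance_const_mul, variance_of_integral_eq_zero
    (h.memLp_integral_comp hm).aestronglyMeasurable.aemeasurable
    (h.integral_integral_hermiteEval_eq_zero hκ)]
  have := h.integral_mul_integral_hermiteEval (μ := μ) hm κ
  rw [hermiteCoeff_hermiteEval, if_pos rfl] at this
  simp only [pow_two (∫ _, _ ∂_)]
  rw [this]
  ring

theorem HasRegularlyVaryingCovariance.ae_integral_hermiteRemainder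
    (h : HasRegularlyVaryingCovariance η P α L₀) (hG : HasHermiteRank G κ) :
    (fun ω => ∫ x, hermiteRemainder G κ (η x ω) ∂μ) =ᵐ[P] (fun ω => ∫ x, G (η x ω) ∂μ)
      - fun ω => hermiteCoeff G κ / (κ.factorial : ℝ) * ∫ x, hermiteEval κ (η x ω) ∂μ := by
  filter_upwards [h.ae_integrable_comp (μ := μ) hG.memLp,
    h.ae_integrable_comp (μ := μ) (memLp_hermiteEval κ 2 (by simp))] with ω h1 h2
  simp only [Pi.sub_apply]
  rw [← integral_const_mul, ← integral_sub h1 (h2.const_mul _)]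
  rfl

theorem HasRegularlyVaryingCovariance.variance_sub_hermite_le
    (h : HasRegularlyVaryingCovariance η P α L₀) (hd : 0 < d) (hG : HasHermiteRank G κ) :
    Var[(fun ω => ∫ x, G (η x ω) ∂μ) - fun ω =>
        hermiteCoeff G κ / (κ.factorial : ℝ) * ∫ x, hermiteEval κ (η x ω) ∂μ; P]
      ≤ (∫ p, cov[η p.1, η p.2; P] ^ (κ + 1) ∂(μ.prod μ))
        * ∫ w, hermiteRemainder G κ w ^ 2 ∂(gaussianReal 0 1) := by
  rw [← variance_congr (h.ae_integral_hermiteRemainder (μ := μ) hG)]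
  refine (variance_le_expectation_sq
    (h.memLp_integral_comp hG.memLp_hermiteRemainder).aestronglyMeasurable).trans ?_
  exact h.integral_sq_integral_comp_le hd hG.memLp_hermiteRemainder
    fun j hj => hG.hermiteCoeff_hermiteRemainder hj

/-- The remainder has zero Hermite coefficient of order `κ`, so its integral is uncorrelated with
that of `H_κ`. -/
theorem HasRegularlyVaryingCovariance.variance_eq_add
    (h : HasRegularlyVaryingCovariance η P α L₀) (hG : HasHermiteRank G κ) :
    Var[fun ω => ∫ x, G (η x ω) ∂μ; P]
      = Var[fun ω => hermiteCoeff G κ / (κ.factorial : ℝ) * ∫ x, hermiteEval κ (η x ω) ∂μ; P]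
      + Var[(fun ω => ∫ x, G (η x ω) ∂μ) - fun ω =>
        hermiteCoeff G κ / (κ.factorial : ℝ) * ∫ x, hermiteEval κ (η x ω) ∂μ; P] := by
  have hm := memLp_hermiteEval κ 2 (by simp)
  set c := hermiteCoeff G κ / (κ.factorial : ℝ)
  set U : Ω → ℝ := fun ω => c * ∫ x, hermiteEval κ (η x ω) ∂μ with hU
  set R : Ω → ℝ := fun ω => ∫ x, hermiteRemainder G κ (η x ω) ∂μ with hR
  have hRae : R =ᵐ[P] (fun ω => ∫ x, G (η x ω) ∂μ) - U := h.ae_integral_hermiteRemainder hG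
  have hU2 : MemLp U 2 P := (h.memLp_integral_comp hm).const_mul c
  have hR2 : MemLp R 2 P := h.memLp_integral_comp hG.memLp_hermiteRemainder
  have hsum : (fun ω => ∫ x, G (η x ω) ∂μ) =ᵐ[P] U + R := by
    filter_upwards [hRae] with ω hω
    simp [hω]
  have hcov : cov[U, R; P] = 0 := by
    have hmean : ∫ ω, U ω ∂P = 0 := by
      rw [hU, integral_const_mul, h.integral_integral_hermiteEval_eq_zero hG.one_le, mul_zero]
    rw [covariance_eq_sub hU2 hR2, hmean, zero_mul, sub_zero]
    have := h.integral_mul_integral_hermiteEval (μ := μ) hG.memLp_hermiteRemainder κ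
    rw [hG.hermiteCoeff_hermiteRemainder (Nat.lt_succ_self κ), mul_zero] at this
    rw [← mul_zero c, ← this, ← integral_const_mul]
    refine integral_congr_ae (ae_of_all _ fun ω => ?_)
    simp only [Pi.mul_apply, hU, hR]
    ring
  rw [variance_congr hsum, variance_add hU2 hR2, hcov, ← variance_congr hRae]
  ring

theorem HasRegularlyVaryingCovariance.integral_covariance_pow_pos
    (h : HasRegularlyVaryingCovariance η P α L₀) (hd : 0 < d) (hμ : μ ≠ 0) (k : ℕ) :
    0 < ∫ p, cov[η p.1, η p.2; P] ^ k ∂(μ.prod μ) := by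
  have hpos (p : EuclideanSpace ℝ (Fin d) × EuclideanSpace ℝ (Fin d)) :
      0 < cov[η p.1, η p.2; P] ^ k := pow_pos (h.covariance_pos hd _ _) k
  rw [integral_pos_iff_support_of_nonneg (fun p => (hpos p).le)
    (h.integrable_covariance_pow hd k)]
  have : (Function.support fun p : EuclideanSpace ℝ (Fin d) × EuclideanSpace ℝ (Fin d) =>
      cov[η p.1, η p.2; P] ^ k) = Set.univ :=
    Set.eq_univ_of_forall fun p => (hpos p).ne'
  rw [this, ← Set.univ_prod_univ, Measure.prod_prod]
  have := Measure.measure_univ_pos.2 hμ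
  exact ENNReal.mul_pos this.ne' this.ne'

end Field

/-! ### Surface measure of dilated hypersurfaces -/

theorem frontier_smul_of_ne_zero {E : Type*} [NormedAddCommGroup E] [NormedSpace ℝ E] {r : ℝ}
    (hr : r ≠ 0) (s : Set E) : frontier (r • s) = r • frontier s := by
  simpa using ((Homeomorph.smulOfNeZero r hr).image_frontier s).symm

section Surface

variable {d : ℕ} {S : Set (EuclideanSpace ℝ (Fin d))}

theorem IsAhlforsDavidRegularHypersurface.measure_lt_top
    (h : IsAhlforsDavidRegularHypersurface S) (hb : Bornology.IsBounded S) :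
    μHE[d - 1] S < ⊤ := by
  obtain ⟨-, hn, C, -, hC⟩ := h
  obtain ⟨y, hy⟩ := hn.nonempty
  -- The radius exceeds the diameter, so the open ball contains all of `S`.
  have h1 := (hC y hy (Metric.diam S + 1) (by linarith [Metric.diam_nonneg (s := S)])).2
  rw [Set.inter_eq_left.2] at h1
  · exact h1.trans ENNReal.ofReal_lt_top
  · intro x hx
    rw [Metric.mem_ball]
    linarith [Metric.dist_le_diam_of_mem hb hx hy]

theorem IsAhlforsDavidRegularHypersurface.measure_pos
    (h : IsAhlforsDavidRegularHypersurface S) (hb : Bornology.IsBounded S) :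
    0 < μHE[d - 1] S := by
  obtain ⟨-, hn, C, -, hC⟩ := h
  obtain ⟨x, hx, y, hy, hxy⟩ := hn
  have hdiam : 0 < Metric.diam S :=
    (dist_pos.2 hxy).trans_le (Metric.dist_le_diam_of_mem hb hx hy)
  exact (bot_le.trans_lt ((hC y hy _ hdiam).1 le_rfl)).trans_le
    (measure_mono Set.inter_subset_left)

/-- The constant does not depend on `r`: dilation multiplies surface measure by `r ^ (d - 1)`, which
cancels the rescaling of the radius to `s / r`. -/
theorem IsAhlforsDavidRegularHypersurface.exists_measure_smul_inter_ball_le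
    (h : IsAhlforsDavidRegularHypersurface S) :
    ∃ C : ℝ, 0 < C ∧ ∀ r : ℝ, 0 < r → ∀ y ∈ r • S, ∀ s : ℝ, 0 < s →
      μHE[d - 1] (r • S ∩ Metric.ball y s) ≤ ENNReal.ofReal (C * s ^ (d - 1)) := by
  obtain ⟨-, -, C, hC0, hC⟩ := h
  refine ⟨C, hC0, fun r hr y hy s hs => ?_⟩
  obtain ⟨x, hx, rfl⟩ := hy
  have hball : Metric.ball (r • x) s = r • Metric.ball x (s / r) := by
    rw [smul_ball hr.ne', Real.norm_of_nonneg hr.le, mul_div_cancel₀ _ hr.ne']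
  have hle := (hC x hx (s / r) (by positivity)).2.le
  simp only
  rw [hball, ← Set.smul_set_inter₀ hr.ne', Measure.euclideanHausdorffMeasure_smul₀ _ hr.ne']
  calc ‖r‖₊ ^ (d - 1) • μHE[d - 1] (S ∩ Metric.ball x (s / r))
      ≤ ‖r‖₊ ^ (d - 1) • ENNReal.ofReal (C * (s / r) ^ (d - 1)) := by gcongr
    _ = ENNReal.ofReal (C * s ^ (d - 1)) := by
      rw [ENNReal.smul_def, smul_eq_mul, ← ENNReal.ofReal_coe_nnreal,
        ← ENNReal.ofReal_mul (by positivity)]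
      congr 1
      rw [NNReal.coe_pow, coe_nnnorm, Real.norm_of_nonneg hr.le, div_pow]
      field_simp

/-- The functionals are indexed by all real `r`, so `r ≤ 0` is included. At `r = 0` the frontier is
at most a point, which is null because `d - 1 ≥ 1`. -/
theorem isFiniteMeasure_restrict_frontier_smul (hd : 2 ≤ d)
    {Δ : Set (EuclideanSpace ℝ (Fin d))} (hΔ : Bornology.IsBounded Δ)
    (h : IsAhlforsDavidRegularHypersurface (frontier Δ)) (r : ℝ) :
    IsFiniteMeasure ((μHE[d - 1] : Measure (EuclideanSpace ℝ (Fin d))).restrict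
      (frontier (r • Δ))) := by
  rw [isFiniteMeasure_restrict]
  rcases eq_or_ne r 0 with rfl | hr
  · have hsub : frontier ((0 : ℝ) • Δ) ⊆ {0} := by
      refine frontier_subset_closure.trans ?_
      exact closure_minimal (Set.zero_smul_set_subset Δ) isClosed_singleton
    refine ((measure_mono hsub).trans_lt ?_).ne
    rw [Measure.euclideanHausdorffMeasure_def, Measure.smul_apply]
    have : NullSingletonClass (μH[((d - 1 : ℕ) : ℝ)] : Measure (EuclideanSpace ℝ (Fin d))) :=
      Measure.nullSingletonClass_hausdorff _ (by
        have : 0 < d - 1 := by omega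
        exact_mod_cast this)
    rw [measure_singleton, smul_zero]
    exact ENNReal.zero_lt_top
  · rw [frontier_smul_of_ne_zero hr, Measure.euclideanHausdorffMeasure_smul₀ _ hr,
      ENNReal.smul_def, smul_eq_mul]
    exact ENNReal.mul_ne_top ENNReal.coe_ne_top (h.measure_lt_top
      ((hΔ.closure).subset frontier_subset_closure)).ne

theorem measureReal_restrict_frontier_smul {Δ : Set (EuclideanSpace ℝ (Fin d))} {r : ℝ}
    (hr : 0 < r) :
    ((μHE[d - 1] : Measure (EuclideanSpace ℝ (Fin d))).restrict (frontier (r • Δ))).real Set.univ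
      = r ^ (d - 1) * (μHE[d - 1] (frontier Δ)).toReal := by
  rw [measureReal_def, Measure.restrict_apply_univ, frontier_smul_of_ne_zero hr.ne',
    Measure.euclideanHausdorffMeasure_smul₀ _ hr.ne', ENNReal.smul_def, smul_eq_mul,
    ENNReal.toReal_mul]
  simp [abs_of_pos hr]

/-- Pairs of close points have small measure. -/
theorem prod_measureReal_dist_lt_le {X : Type*} [PseudoMetricSpace X] [SecondCountableTopology X]
    [MeasurableSpace X] [BorelSpace X] {μ : Measure X} [IsFiniteMeasure μ] {T B : ℝ} (hB : 0 ≤ B)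
    (h : ∀ᵐ x ∂μ, μ (Metric.ball x T) ≤ ENNReal.ofReal B) :
    (μ.prod μ).real {p | dist p.1 p.2 < T} ≤ B * μ.real Set.univ := by
  have hm : MeasurableSet {p : X × X | dist p.1 p.2 < T} :=
    measurableSet_lt (by fun_prop) measurable_const
  have hle : (μ.prod μ) {p | dist p.1 p.2 < T} ≤ ENNReal.ofReal B * μ Set.univ := by
    rw [Measure.prod_apply hm, ← lintegral_const]
    refine lintegral_mono_ae ?_
    filter_upwards [h] with x hx
    convert hx using 2
    ext y
    simp [dist_comm]
  have := ENNReal.toReal_mono (ENNReal.mul_ne_top ENNReal.ofReal_ne_top (measure_ne_top _ _)) hle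
  rwa [ENNReal.toReal_mul, ENNReal.toReal_ofReal hB] at this

/-! ### Asymptotics of the integrated powers of the covariance -/

variable {Ω : Type*} [MeasurableSpace Ω] {P : Measure Ω} [IsProbabilityMeasure P]
  {η : EuclideanSpace ℝ (Fin d) → Ω → ℝ} {α : ℝ} {L₀ : ℝ → ℝ}

theorem HasRegularlyVaryingCovariance.exists_covariance_le
    (h : HasRegularlyVaryingCovariance η P α L₀) (hd : 0 < d) (hα : 0 < α) {ε : ℝ} (hε : 0 < ε) :
    ∃ T : ℝ, 0 < T ∧ ∀ x y, T ≤ dist x y → cov[η x, η y; P] ≤ ε := by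
  obtain ⟨ρ, hρc, -, -, hρ, hcov⟩ := h.exists_correlation hd
  have hc := continuousOn_of_eq_rpow_neg_mul hρc.continuousOn hρ
  obtain ⟨T, hT⟩ := eventually_atTop.1
    ((h.slowlyVarying.tendsto_rpow_neg_mul hc hα).eventually_le_const hε)
  refine ⟨max T 1, by positivity, fun x y hxy => ?_⟩
  have h1 : T ≤ dist x y := (le_max_left _ _).trans hxy
  have h2 : 0 < dist x y := one_pos.trans_le ((le_max_right _ _).trans hxy)
  rw [hcov, hρ _ h2]
  exact hT _ h1

theorem HasRegularlyVaryingCovariance.exists_le_covariance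
    (h : HasRegularlyVaryingCovariance η P α L₀) (hd : 0 < d) (hα : 0 < α) {β : ℝ} (hβ : α < β) :
    ∃ c : ℝ, 0 < c ∧ ∀ x y, c * (1 + dist x y) ^ (-β) ≤ cov[η x, η y; P] := by
  obtain ⟨ρ, hρc, hpos, -, hρ, hcov⟩ := h.exists_correlation hd
  obtain ⟨c, hc, hle⟩ := exists_mul_rpow_le_of_isSlowlyVarying h.slowlyVarying hρc.continuousOn
    hpos hα hβ hρ
  exact ⟨c, hc, fun x y => by rw [hcov]; exact hle _ dist_nonneg⟩

theorem HasRegularlyVaryingCovariance.integral_covariance_pow_succ_le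
    (h : HasRegularlyVaryingCovariance η P α L₀) (hd : 0 < d)
    {μ : Measure (EuclideanSpace ℝ (Fin d))} [IsFiniteMeasure μ] {T ε : ℝ} (hε : 0 ≤ ε)
    (hT : ∀ x y, T ≤ dist x y → cov[η x, η y; P] ≤ ε) (k : ℕ) :
    ∫ p, cov[η p.1, η p.2; P] ^ (k + 1) ∂(μ.prod μ)
      ≤ ε * (∫ p, cov[η p.1, η p.2; P] ^ k ∂(μ.prod μ))
        + (μ.prod μ).real {p | dist p.1 p.2 < T} := by
  have hm : MeasurableSet {p : EuclideanSpace ℝ (Fin d) × EuclideanSpace ℝ (Fin d) |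
      dist p.1 p.2 < T} := measurableSet_lt (by fun_prop) measurable_const
  have i1 := (h.integrable_covariance_pow (μ := μ) hd k).const_mul ε
  have i2 : Integrable (Set.indicator {p : EuclideanSpace ℝ (Fin d) × EuclideanSpace ℝ (Fin d) |
      dist p.1 p.2 < T} (1 : EuclideanSpace ℝ (Fin d) × EuclideanSpace ℝ (Fin d) → ℝ)) (μ.prod μ) := (integrable_const (1 : ℝ)).indicator hm
  rw [← integral_const_mul, ← integral_indicator_one hm, ← integral_add i1 i2]
  refine integral_mono (h.integrable_covariance_pow hd _) (i1.add i2) fun p => ?_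
  have h0 := (h.covariance_pos hd p.1 p.2).le
  have h1 := h.covariance_le_one p.1 p.2
  simp only [Set.indicator_apply, Set.mem_ofPred_eq, Pi.one_apply]
  split_ifs with hp
  · have := pow_le_one₀ (n := k + 1) h0 h1
    have := mul_nonneg hε (pow_nonneg h0 k)
    linarith
  · rw [pow_succ', add_zero]
    exact mul_le_mul_of_nonneg_right (hT _ _ (not_lt.1 hp)) (pow_nonneg h0 k)

theorem HasRegularlyVaryingCovariance.le_integral_covariance_pow
    (h : HasRegularlyVaryingCovariance η P α L₀) (hd : 0 < d)
    {μ : Measure (EuclideanSpace ℝ (Fin d))} [IsFiniteMeasure μ] {c β D : ℝ} (hc : 0 < c)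
    (hβ : 0 < β) (hle : ∀ x y, c * (1 + dist x y) ^ (-β) ≤ cov[η x, η y; P])
    {S : Set (EuclideanSpace ℝ (Fin d))} (hS : ∀ᵐ x ∂μ, x ∈ S)
    (hD : ∀ x ∈ S, ∀ y ∈ S, dist x y ≤ D) (k : ℕ) :
    (c * (1 + D) ^ (-β)) ^ k * μ.real Set.univ ^ 2
      ≤ ∫ p, cov[η p.1, η p.2; P] ^ k ∂(μ.prod μ) := by
  have hae : ∀ᵐ p ∂(μ.prod μ), p.1 ∈ S ∧ p.2 ∈ S :=
    (Measure.quasiMeasurePreserving_fst.ae hS).and (Measure.quasiMeasurePreserving_snd.ae hS)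
  have hconst : (c * (1 + D) ^ (-β)) ^ k * μ.real Set.univ ^ 2
      = ∫ _, (c * (1 + D) ^ (-β)) ^ k ∂(μ.prod μ) := by
    rw [integral_const, smul_eq_mul, mul_comm, ← Set.univ_prod_univ, measureReal_prod_prod]
    ring
  rw [hconst]
  refine integral_mono_ae (integrable_const _) (h.integrable_covariance_pow hd k) ?_
  filter_upwards [hae] with p hp
  have hdist := hD _ hp.1 _ hp.2
  have hD0 : 0 ≤ D := dist_nonneg.trans hdist
  have h1 : (1 + D) ^ (-β) ≤ (1 + dist p.1 p.2) ^ (-β) :=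
    Real.rpow_le_rpow_of_nonpos (by positivity) (by linarith) (by linarith)
  refine pow_le_pow_left₀ (by positivity) ?_ k
  exact (mul_le_mul_of_nonneg_left h1 hc.le).trans (hle _ _)

/-- Over dilated hypersurfaces, the integrals of the `(κ+1)`-st power of the covariance are
negligible with respect to those of the `κ`-th power. -/
theorem HasRegularlyVaryingCovariance.tendsto_integral_covariance_pow_div
    (h : HasRegularlyVaryingCovariance η P α L₀) (hd : 2 ≤ d) (hα : 0 < α) {κ : ℕ} (hκ : 1 ≤ κ)
    (hακ : α < ((d : ℝ) - 1) / κ) {Δ : Set (EuclideanSpace ℝ (Fin d))}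
    (hΔ : Bornology.IsBounded Δ) (hreg : IsAhlforsDavidRegularHypersurface (frontier Δ))
    {μ : ℝ → Measure (EuclideanSpace ℝ (Fin d))}
    (hμ : ∀ r, μ r = (μHE[d - 1]).restrict (frontier (r • Δ))) :
    Tendsto (fun r => (∫ p, cov[η p.1, η p.2; P] ^ (κ + 1) ∂((μ r).prod (μ r)))
      / ∫ p, cov[η p.1, η p.2; P] ^ κ ∂((μ r).prod (μ r))) atTop (𝓝 0) := by
  have hd0 : 0 < d := by omega
  have hfin (r : ℝ) : IsFiniteMeasure (μ r) := by
    rw [hμ]; exact isFiniteMeasure_restrict_frontier_smul hd hΔ hreg r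
  have hSb : Bornology.IsBounded (frontier Δ) := hΔ.closure.subset frontier_subset_closure
  -- The gap between `α` and `β` absorbs the slowly varying factor, while `β * κ < d - 1` is kept.
  obtain ⟨β, hαβ, hβκ⟩ := exists_between hακ
  have hκ0 : (0 : ℝ) < κ := by exact_mod_cast hκ
  rw [lt_div_iff₀ hκ0] at hβκ
  have hβ : 0 < β := hα.trans hαβ
  obtain ⟨c, hc, hcle⟩ := h.exists_le_covariance hd0 hα hαβ
  obtain ⟨C, hC, hCle⟩ := hreg.exists_measure_smul_inter_ball_le
  set m := (μHE[d - 1] (frontier Δ)).toReal with hm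
  have hm0 : 0 < m := ENNReal.toReal_pos (hreg.measure_pos hSb).ne' (hreg.measure_lt_top hSb).ne
  set D := Metric.diam (frontier Δ)
  have hD0 : 0 ≤ D := Metric.diam_nonneg
  have hmass (r : ℝ) (hr : 0 < r) : (μ r).real Set.univ = r ^ (d - 1) * m := by
    rw [hμ, measureReal_restrict_frontier_smul hr]
  have hmem (r : ℝ) (hr : 0 < r) : ∀ᵐ x ∂(μ r), x ∈ r • frontier Δ := by
    rw [hμ, frontier_smul_of_ne_zero hr.ne']
    refine ae_restrict_mem ?_
    exact (isClosed_frontier.smul_of_ne_zero hr.ne').measurableSet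
  have hlow (r : ℝ) (hr : 0 < r) := h.le_integral_covariance_pow hd0 (μ := μ r) (D := r * D) hc hβ
    hcle (hmem r hr) (by
      rintro _ ⟨x, hx, rfl⟩ _ ⟨y, hy, rfl⟩
      simp only
      rw [dist_smul₀, Real.norm_of_nonneg hr.le]
      exact mul_le_mul_of_nonneg_left (Metric.dist_le_diam_of_mem hSb hx hy) hr.le) κ
  have hpos (r : ℝ) (hr : 0 < r) :
      0 < ∫ p, cov[η p.1, η p.2; P] ^ κ ∂((μ r).prod (μ r)) := by
    refine lt_of_lt_of_le ?_ (hlow r hr)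
    rw [hmass r hr]
    positivity
  -- Up to constants, this is the bound `r ^ (d - 1)` for close pairs divided by the lower bound `r
  -- ^ (2 * (d - 1)) * (1 + r * D) ^ (-(β * κ))` for the integral of `B ^ κ`.
  have hdecay : Tendsto (fun r : ℝ => (r ^ (d - 1))⁻¹ * (1 + r * D) ^ (β * κ)) atTop (𝓝 0) := by
    have hexp : 0 < ((d : ℝ) - 1) - β * κ := by linarith
    have hlim := (tendsto_rpow_neg_atTop hexp).mul_const ((1 + D) ^ (β * κ))
    rw [zero_mul] at hlim
    refine squeeze_zero' ?_ ?_ hlim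
    · filter_upwards [eventually_gt_atTop 0] with r hr
      positivity
    · filter_upwards [eventually_ge_atTop 1] with r hr
      have hr0 : 0 < r := by linarith
      calc (r ^ (d - 1))⁻¹ * (1 + r * D) ^ (β * κ)
          ≤ (r ^ (d - 1))⁻¹ * (r * (1 + D)) ^ (β * κ) := by
            gcongr
            linarith
        _ = r ^ (-(((d : ℝ) - 1) - β * κ)) * (1 + D) ^ (β * κ) := by
            rw [Real.mul_rpow hr0.le (by positivity), ← Real.rpow_natCast, ← Real.rpow_neg hr0.le,
              ← mul_assoc, ← Real.rpow_add hr0]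
            congr 2
            rw [Nat.cast_sub (by omega)]
            push_cast
            ring
  rw [Metric.tendsto_atTop']
  intro ε hε
  -- Half of `ε` is spent on the pairs at distance at least `T`, half on the closer ones. `T` is
  -- fixed before `r` grows.
  obtain ⟨T, hT0, hT⟩ := h.exists_covariance_le hd0 hα (half_pos hε)
  have hsmall : ∀ᶠ r : ℝ in atTop,
      C * T ^ (d - 1) / (c ^ κ * m) * ((r ^ (d - 1))⁻¹ * (1 + r * D) ^ (β * κ)) < ε / 2 := by
    have := hdecay.const_mul (C * T ^ (d - 1) / (c ^ κ * m))
    rw [mul_zero] at this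
    exact this.eventually_lt_const (half_pos hε)
  obtain ⟨R, hR⟩ := eventually_atTop.1 (hsmall.and (eventually_gt_atTop 0))
  refine ⟨R, fun r hr => ?_⟩
  obtain ⟨hr1, hr0⟩ := hR r hr.le
  have hJ := hpos r hr0
  have hup := h.integral_covariance_pow_succ_le hd0 (μ := μ r) (half_pos hε).le hT κ
  have hball : ∀ᵐ x ∂(μ r), μ r (Metric.ball x T) ≤ ENNReal.ofReal (C * T ^ (d - 1)) := by
    filter_upwards [hmem r hr0] with x hx
    rw [hμ, Measure.restrict_apply measurableSet_ball, frontier_smul_of_ne_zero hr0.ne',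
      Set.inter_comm]
    exact hCle r hr0 x hx T hT0
  have hclose := prod_measureReal_dist_lt_le (by positivity) hball
  have hnn : 0 ≤ ∫ p, cov[η p.1, η p.2; P] ^ (κ + 1) ∂((μ r).prod (μ r)) :=
    integral_nonneg fun p => pow_nonneg (h.covariance_pos hd0 _ _).le _
  rw [dist_zero_right, Real.norm_of_nonneg (div_nonneg hnn hJ.le), div_lt_iff₀ hJ]
  have hkey : C * T ^ (d - 1) * (μ r).real Set.univ
      < ε / 2 * ∫ p, cov[η p.1, η p.2; P] ^ κ ∂((μ r).prod (μ r)) := by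
    refine lt_of_lt_of_le ?_ (mul_le_mul_of_nonneg_left (hlow r hr0) (half_pos hε).le)
    rw [hmass r hr0, mul_pow c, ← Real.rpow_natCast ((1 + r * D) ^ (-β)),
      ← Real.rpow_mul (by positivity), neg_mul, Real.rpow_neg (by positivity)]
    have hW : 0 < (1 + r * D) ^ (β * κ) := by positivity
    have hrd : 0 < r ^ (d - 1) := by positivity
    have hck : 0 < c ^ κ := by positivity
    calc C * T ^ (d - 1) * (r ^ (d - 1) * m)
        = (C * T ^ (d - 1) / (c ^ κ * m) * ((r ^ (d - 1))⁻¹ * (1 + r * D) ^ (β * κ)))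
          * (c ^ κ * ((1 + r * D) ^ (β * κ))⁻¹ * (r ^ (d - 1) * m) ^ 2) := by
          field_simp
      _ < ε / 2 * (c ^ κ * ((1 + r * D) ^ (β * κ))⁻¹ * (r ^ (d - 1) * m) ^ 2) :=
          mul_lt_mul_of_pos_right hr1 (by positivity)
  linarith

end Surface

/-! ### Limit distributions -/

section Limit

variable {Ω : Type*} [MeasurableSpace Ω] {P : Measure Ω}

theorem tendstoInMeasure_of_tendsto_integral_sq {Z : ℝ → Ω → ℝ} (hZ : ∀ r, MemLp (Z r) 2 P)
    (h : Tendsto (fun r => ∫ ω, Z r ω ^ 2 ∂P) atTop (𝓝 0)) :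
    TendstoInMeasure P Z atTop 0 := by
  refine tendstoInMeasure_of_tendsto_eLpNorm (p := 2) (by norm_num)
    (fun r => (hZ r).aestronglyMeasurable) aestronglyMeasurable_zero ?_
  have h1 := ENNReal.tendsto_ofReal h.sqrt
  simp only [Real.sqrt_zero, ENNReal.ofReal_zero] at h1
  refine h1.congr fun r => ?_
  rw [sub_zero, (hZ r).eLpNorm_eq_integral_rpow_norm (by norm_num) (by norm_num)]
  simp [Real.sqrt_eq_rpow]

variable [IsProbabilityMeasure P]

theorem hasLimitDistribution_of_tendsto_integral_sq_sub {X Y : ℝ → Ω → ℝ}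
    (hX : ∀ r, MemLp (X r) 2 P) (hY : ∀ r, MemLp (Y r) 2 P)
    (h : Tendsto (fun r => ∫ ω, (Y r ω - X r ω) ^ 2 ∂P) atTop (𝓝 0))
    {ν : Measure ℝ} [IsProbabilityMeasure ν] (hlim : HasLimitDistribution P X ν) :
    HasLimitDistribution P Y ν :=
  tendstoInDistribution_of_tendstoInMeasure_sub Y id hlim
    (tendstoInMeasure_of_tendsto_integral_sq (Z := Y - X) (fun r => (hY r).sub (hX r)) h)
    fun r => (hY r).aestronglyMeasurable.aemeasurable

theorem hasLimitDistribution_iff_of_tendsto_integral_sq_sub {X Y : ℝ → Ω → ℝ}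
    (hX : ∀ r, MemLp (X r) 2 P) (hY : ∀ r, MemLp (Y r) 2 P)
    (h : Tendsto (fun r => ∫ ω, (Y r ω - X r ω) ^ 2 ∂P) atTop (𝓝 0))
    {ν : Measure ℝ} [IsProbabilityMeasure ν] :
    HasLimitDistribution P X ν ↔ HasLimitDistribution P Y ν :=
  ⟨hasLimitDistribution_of_tendsto_integral_sq_sub hX hY h,
    hasLimitDistribution_of_tendsto_integral_sq_sub hY hX (by
      refine h.congr fun r => integral_congr_ae (ae_of_all _ fun ω => ?_)
      simp only
      ring)⟩

/-- Limit distributions of two standardised centred families whose difference is negligible in mean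
square. -/
theorem tfae_hasLimitDistribution {K U : ℝ → Ω → ℝ} (hK : ∀ r, MemLp (K r) 2 P)
    (hU : ∀ r, MemLp (U r) 2 P) (hK0 : ∀ r, ∫ ω, K r ω ∂P = 0) (hU0 : ∀ r, ∫ ω, U r ω ∂P = 0)
    (hpos : ∀ r, 0 < r → 0 < Var[U r; P])
    (hadd : ∀ r, Var[K r; P] = Var[U r; P] + Var[K r - U r; P])
    (hlim : Tendsto (fun r => Var[K r - U r; P] / Var[U r; P]) atTop (𝓝 0))
    (ν : Measure ℝ) [IsProbabilityMeasure ν] :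
    List.TFAE [
      HasLimitDistribution P (fun r ω => K r ω / √(Var[K r; P])) ν,
      HasLimitDistribution P (fun r ω => K r ω / √(Var[U r; P])) ν,
      HasLimitDistribution P (fun r ω => U r ω / √(Var[U r; P])) ν] := by
  have hdiv {X : Ω → ℝ} (hX : MemLp X 2 P) (c : ℝ) : MemLp (fun ω => X ω / c) 2 P := by
    simpa only [div_eq_mul_inv] using hX.mul_const c⁻¹
  have hsq {X : Ω → ℝ} (hX : MemLp X 2 P) (h0 : ∫ ω, X ω ∂P = 0) :
      ∫ ω, X ω ^ 2 ∂P = Var[X; P] :=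
    (variance_of_integral_eq_zero hX.aestronglyMeasurable.aemeasurable h0).symm
  tfae_have 1 ↔ 2 := by
    refine hasLimitDistribution_iff_of_tendsto_integral_sq_sub (fun r => hdiv (hK r) _)
      (fun r => hdiv (hK r) _) ?_
    -- The mean-square distance between the two normalisations of `K` equals `(√(Var K / Var U) - 1)
    -- ^ 2`, and `hadd` rewrites the variance ratio.
    have h1 : Tendsto (fun r => (√(1 + Var[K r - U r; P] / Var[U r; P]) - 1) ^ 2)
        atTop (𝓝 0) := by
      simpa using (((hlim.const_add 1).sqrt).sub_const 1).pow 2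
    refine h1.congr' ?_
    filter_upwards [eventually_gt_atTop 0] with r hr
    have hv := hpos r hr
    have hw : 0 < Var[K r; P] := by
      rw [hadd]; linarith [variance_nonneg (K r - U r) P]
    have e : ∀ ω, (K r ω / √(Var[U r; P]) - K r ω / √(Var[K r; P])) ^ 2
        = ((√(Var[U r; P]))⁻¹ - (√(Var[K r; P]))⁻¹) ^ 2 * K r ω ^ 2 := fun ω => by
      rw [← mul_pow]; congr 1; ring
    simp only [e]
    rw [integral_const_mul, hsq (hK r) (hK0 r)]
    have e2 : 1 + Var[K r - U r; P] / Var[U r; P] = Var[K r; P] / Var[U r; P] := by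
      rw [hadd]; field_simp
    rw [e2, Real.sqrt_div hw.le]
    have hsw := Real.sqrt_pos.2 hw
    have hsv := Real.sqrt_pos.2 hv
    have hw2 := Real.sq_sqrt hw.le
    generalize √(Var[K r; P]) = a at *
    rw [← hw2]
    field_simp
  tfae_have 2 ↔ 3 := by
    refine Iff.symm (hasLimitDistribution_iff_of_tendsto_integral_sq_sub
      (fun r => hdiv (hU r) _) (fun r => hdiv (hK r) _) ?_)
    refine hlim.congr' ?_
    filter_upwards [eventually_gt_atTop 0] with r hr
    have e : ∀ ω, (K r ω / √(Var[U r; P]) - U r ω / √(Var[U r; P])) ^ 2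
        = (Var[U r; P])⁻¹ * (K r - U r) ω ^ 2 := fun ω => by
      rw [← sub_div, div_pow, Real.sq_sqrt (hpos r hr).le, Pi.sub_apply]; ring
    simp only [e]
    rw [integral_const_mul, hsq ((hK r).sub (hU r))]
    · ring
    · have := integral_sub ((hK r).integrable (by norm_num)) ((hU r).integrable (by norm_num))
      rw [hK0, hU0, sub_zero] at this
      exact this
  tfae_finish

end Limit

/-! ### The reduction theorem. -/

theorem mainTheorem1 {d : ℕ} (hd : 2 ≤ d) {Ω : Type*} [MeasurableSpace Ω]
    (P : Measure Ω) [IsProbabilityMeasure P]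
    (Δ : Set (EuclideanSpace ℝ (Fin d))) (hΔ : Bornology.IsBounded Δ)
    (hreg : IsAhlforsDavidRegularHypersurface (frontier Δ))
    (η : EuclideanSpace ℝ (Fin d) → Ω → ℝ) (α : ℝ) (L₀ : ℝ → ℝ)
    (hη : HasRegularlyVaryingCovariance η P α L₀)
    (G : ℝ → ℝ) (κ : ℕ) (hG : HasHermiteRank G κ)
    (hα : 0 < α) (hακ : α < ((d : ℝ) - 1) / κ) :
    let K : ℝ → Ω → ℝ := surfaceFunctional Δ η G
    let Kκ : ℝ → Ω → ℝ := hermiteComponent Δ η G κ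
    -- the random variables are well defined, square integrable and non-degenerate
    (∀ r : ℝ, 0 < r →
      (∀ᵐ ω ∂P, IntegrableOn (fun x => G (η x ω)) (frontier (r • Δ)) μHE[d - 1]) ∧
      (∀ᵐ ω ∂P, IntegrableOn (fun x => hermiteEval κ (η x ω)) (frontier (r • Δ)) μHE[d - 1]) ∧
      MemLp (K r) 2 P ∧ MemLp (Kκ r) 2 P ∧ 0 < Var[K r; P] ∧ 0 < Var[Kκ r; P]) ∧
    -- the part of `K r` of Hermite order larger than `κ` is negligible in mean square
    Tendsto (fun r => Var[K r - Kκ r; P] / Var[K r; P]) atTop (𝓝 0) ∧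
    -- if one of the three has a limit distribution, then all have, and it is the same
    ∀ (ν : Measure ℝ) [IsProbabilityMeasure ν],
      List.TFAE [
        HasLimitDistribution P (fun r ω => K r ω / √(Var[K r; P])) ν,
        HasLimitDistribution P (fun r ω => K r ω / √(Var[Kκ r; P])) ν,
        HasLimitDistribution P (fun r ω => Kκ r ω / √(Var[Kκ r; P])) ν] := by
  intro K Kκ
  have hd0 : 0 < d := by omega
  have hH := memLp_hermiteEval κ 2 (by simp)
  set μ : ℝ → Measure (EuclideanSpace ℝ (Fin d)) :=
    fun r => (μHE[d - 1]).restrict (frontier (r • Δ)) with hμ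
  have hfin (r : ℝ) : IsFiniteMeasure (μ r) :=
    isFiniteMeasure_restrict_frontier_smul hd hΔ hreg r
  set c := hermiteCoeff G κ / (κ.factorial : ℝ) with hc
  have hc0 : c ≠ 0 := div_ne_zero hG.coeff_ne_zero (by positivity)
  have hK2 (r : ℝ) : MemLp (K r) 2 P := hη.memLp_integral_comp (μ := μ r) hG.memLp
  have hU2 (r : ℝ) : MemLp (Kκ r) 2 P :=
    (hη.memLp_integral_comp (μ := μ r) hH).const_mul c
  have hK0 (r : ℝ) : ∫ ω, K r ω ∂P = 0 := by
    have := hη.integral_integral_comp (μ := μ r) hG.memLp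
    rwa [hG.integral_eq_zero, mul_zero] at this
  have hU0 (r : ℝ) : ∫ ω, Kκ r ω ∂P = 0 := by
    have := hη.integral_integral_hermiteEval_eq_zero (μ := μ r) hG.one_le
    calc ∫ ω, Kκ r ω ∂P = c * ∫ ω, ∫ x, hermiteEval κ (η x ω) ∂(μ r) ∂P :=
          integral_const_mul _ _
      _ = 0 := by rw [this, mul_zero]
  have hvU (r : ℝ) : Var[Kκ r; P] = c ^ 2 * κ.factorial
      * ∫ p, cov[η p.1, η p.2; P] ^ κ ∂((μ r).prod (μ r)) :=
    hη.variance_integral_hermiteEval (μ := μ r) hG.one_le c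
  have hadd (r : ℝ) : Var[K r; P] = Var[Kκ r; P] + Var[K r - Kκ r; P] :=
    hη.variance_eq_add (μ := μ r) hG
  have hrem (r : ℝ) : Var[K r - Kκ r; P]
      ≤ (∫ p, cov[η p.1, η p.2; P] ^ (κ + 1) ∂((μ r).prod (μ r)))
        * ∫ w, hermiteRemainder G κ w ^ 2 ∂(gaussianReal 0 1) :=
    hη.variance_sub_hermite_le (μ := μ r) hd0 hG
  have hJ (r : ℝ) (hr : 0 < r) : 0 < ∫ p, cov[η p.1, η p.2; P] ^ κ ∂((μ r).prod (μ r)) := by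
    refine hη.integral_covariance_pow_pos hd0 (fun h0 => ?_) κ
    have hSb : Bornology.IsBounded (frontier Δ) := hΔ.closure.subset frontier_subset_closure
    have hm := measureReal_restrict_frontier_smul (Δ := Δ) hr
    have hpos : 0 < r ^ (d - 1) * (μHE[d - 1] (frontier Δ)).toReal :=
      mul_pos (pow_pos hr _)
        (ENNReal.toReal_pos (hreg.measure_pos hSb).ne' (hreg.measure_lt_top hSb).ne)
    rw [← hm, show (μHE[d - 1]).restrict (frontier (r • Δ)) = 0 from h0] at hpos
    simp at hpos
  have hUpos (r : ℝ) (hr : 0 < r) : 0 < Var[Kκ r; P] := by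
    rw [hvU]
    have := hJ r hr
    positivity
  have hKpos (r : ℝ) (hr : 0 < r) : 0 < Var[K r; P] := by
    rw [hadd]
    linarith [hUpos r hr, variance_nonneg (K r - Kκ r) P]
  have hlim : Tendsto (fun r => Var[K r - Kκ r; P] / Var[Kκ r; P]) atTop (𝓝 0) := by
    have h1 := (hη.tendsto_integral_covariance_pow_div hd hα hG.one_le hακ hΔ hreg
      (μ := μ) fun r => rfl).const_mul
        ((∫ w, hermiteRemainder G κ w ^ 2 ∂(gaussianReal 0 1)) / (c ^ 2 * κ.factorial))
    rw [mul_zero] at h1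
    refine squeeze_zero' (Eventually.of_forall fun r =>
      div_nonneg (variance_nonneg _ _) (variance_nonneg _ _)) ?_ h1
    filter_upwards [eventually_gt_atTop 0] with r hr
    refine (div_le_div_of_nonneg_right (hrem r) (variance_nonneg _ _)).trans_eq ?_
    rw [hvU]
    have := (hJ r hr).ne'
    field_simp
  refine ⟨fun r hr => ⟨hη.ae_integrable_comp (μ := μ r) hG.memLp,
    hη.ae_integrable_comp (μ := μ r) hH, hK2 r, hU2 r, hKpos r hr, hUpos r hr⟩, ?_,
    fun ν _ => tfae_hasLimitDistribution hK2 hU2 hK0 hU0 hUpos hadd hlim ν⟩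
  -- Replacing `Var Kκ` by `Var K`, which is at least as large, only decreases the ratio.
  refine squeeze_zero' (Eventually.of_forall fun r =>
    div_nonneg (variance_nonneg _ _) (variance_nonneg _ _)) ?_ hlim
  filter_upwards [eventually_gt_atTop 0] with r hr
  refine div_le_div_of_nonneg_left (variance_nonneg _ _) (hUpos r hr) ?_
  rw [hadd]
  linarith [variance_nonneg (K r - Kκ r) P]
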